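/- **Notation.** Identify $\mathbb{R}^2$ with $\mathbb{C}$. A (simple) random point process in the plane is a probability measure on the set of locally finite sets $X\subset\mathbb{C}$, with the $\sigma$-algebra generated by the counts $X\mapsto \#(X\cap B)$, $B$ Borel. Its $k$-point correlation function is a nonnegative locally integrable function $\rho_k$ on $\mathbb{C}^k$ with $$\mathbb{E}\sum_{x_1,\dots,x_k\in X\ \text{pairwise distinct}}F(x_1,\dots,x_k)=\int_{\mathbb{C}^k}F\,\rho_k\,dx_1\cdots dx_k$$ for all Borel $F\ge 0$. For $N\in\mathbb{N}$, $N\ge1$, and $x\in\mathbb{C}\setminus N\mathbb{Z}[i]$ let $$E_N(x)=\sum_{(m,n)\in\mathbb{Z}^2\setminus\{0\}}\frac{e^{2\pi i\left(m\,\mathrm{Re}(x/N)+n\,\mathrm{Im}(x/N)\right)}}{|mi+n|^2},$$ the conditionally convergent sum being the limit of the partial sums over $\max(|m|,|n|)\le M$, $M\to\infty$. With the Dedekind function $\eta(\tau)=q^{1/24}\prod_{k\ge1}(1-q^k)$, $q=e^{2\pi i\tau}$, let $$\mathcal{W}_N(X)=\frac{1}{2\pi N^2}\sum_{a\ne b,\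 a,b\in X\cap[0,N]^2}E_N(a-b)+\log\frac{N}{2\pi\,\eta(i)^2}.$$ **Theorem 2.** Consider a random point process in the plane with a one-point correlation function $\rho_1$ and a two-point correlation function $\rho_2$ such that $\rho_1\equiv1$ and $\rho_2(x,y)=1-T_2(x-y)$ for some function $T_2$ (for instance a stationary process of density $1$ with a two-point correlation function). Assume $$\int_{\mathbb{R}^2}|v|^k|T_2(v)|\,dv<\infty\qquad\text{for }k=1,2,3.$$ The expectations $\mathbb{E}\mathcal{W}_N$ below are taken in $[-\infty,+\infty]$. - If $\int_{\mathbb{R}^2}T_2(v)\,dv\neq1$, then $\mathbb{E}\mathcal{W}_N\to+\infty$ as $N\to\infty$. - If $\int_{\mathbb{R}^2}T_2(v)\,dv=1$ and $1-\int_{[-N,N]^2}T_2(v)\,dv=o\big((\log N)^{-1}\big)$, then $\lim_{N\to\infty}\mathbb{E}\mathcal{W}_N$ exists and is finite if and only if $\int_{\mathbb{R}^2}\log|v|\,T_2(v)\,dv$ converges (absolutely), and if so, then $$\lim_{N\to\infty}\mathbb{E}\mathcal{W}_N=\int_{\mathbb{R}^2}\log|v|\,T_2(v)\,dv.$$ 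-/

import Mathlib

open MeasureTheory Filter Topology Asymptotics
open scoped ENNReal

noncomputable section

/-- A locally finite set of (mutually distinct) points of the plane `ℂ`. -/
structure PointConfiguration where
  carrier : Set ℂ
  locallyFinite : ∀ K : Set ℂ, IsCompact K → (carrier ∩ K).Finite

namespace PointConfiguration

/-- The σ-algebra generated by the counting maps `X ↦ #(X ∩ B)`, with `B` Borel. -/
instance instMeasurableSpace : MeasurableSpace PointConfiguration :=
  ⨆ (B : Set ℂ) (_ : MeasurableSet B),
    MeasurableSpace.comap (fun X : PointConfiguration => (X.carrier ∩ B).encard) inferInstance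

/-- The finitely many points of the configuration in the square `[0, N]²`. -/
def pointsInSquare (X : PointConfiguration) (N : ℕ) : Finset ℂ :=
  (X.locallyFinite (Set.Icc 0 (N : ℝ) ×ℂ Set.Icc 0 (N : ℝ))
    (isCompact_Icc.reProdIm isCompact_Icc)).toFinset

end PointConfiguration

/-- `ρ` is the `k`-point correlation function of the point process with law `P`: a nonnegative
locally integrable function such that, for every Borel `F ≥ 0`,
`𝔼 ∑ F(x₁, …, x_k) = ∫ F ρ`, the sum being over the `k`-tuples of pairwise distinct points of the
process. -/
structure IsCorrelationFunction (P : Measure PointConfiguration) (k : ℕ)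
    (ρ : (Fin k → ℂ) → ℝ) : Prop where
  measurable : Measurable ρ
  nonneg : ∀ x, 0 ≤ ρ x
  locallyIntegrable : LocallyIntegrable ρ volume
  lintegral_eq : ∀ F : (Fin k → ℂ) → ℝ≥0∞, Measurable F →
    ∫⁻ X, (∑' x : Fin k ↪ X.carrier, F (fun i => (x i : ℂ))) ∂P =
      ∫⁻ x, F x * ENNReal.ofReal (ρ x)

/-- The Eisenstein series `E_{u,v}(τ) = ∑_{(m,n) ≠ (0,0)} e^{2πi(mu+nv)} Im τ / |mτ + n|²`.
It converges only conditionally (for `(u, v) ∉ ℤ²`), so it is the limit of its partial sums over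
the squares `max(|m|, |n|) ≤ M`. -/
def eisensteinUV (u v : ℝ) (τ : ℂ) : ℂ :=
  limUnder atTop fun M : ℕ =>
    ∑ p ∈ (Finset.Icc (-(M : ℤ)) M ×ˢ Finset.Icc (-(M : ℤ)) M).erase (0, 0),
      Complex.exp (2 * Real.pi * Complex.I * (p.1 * u + p.2 * v)) *
        ((τ.im / ‖(p.1 : ℂ) * τ + p.2‖ ^ 2 : ℝ) : ℂ)

/-- `E_N(x) = E_{Re(x/N), Im(x/N)}(i)`; this is a real number, the terms `(m, n)` and `(-m, -n)`
of the series being conjugate. -/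
def eisensteinN (N : ℕ) (x : ℂ) : ℝ :=
  (eisensteinUV (x / N).re (x / N).im Complex.I).re

/-- The renormalized energy `𝒲_N` of a configuration in the square `[0, N]²`. The sum is over
ordered pairs of distinct points, and `‖η(i)‖ = η(i)` since `η(i) > 0`. -/
def renormalizedEnergy (N : ℕ) (X : PointConfiguration) : ℝ :=
  1 / (2 * Real.pi * (N : ℝ) ^ 2) *
      ∑ p ∈ (X.pointsInSquare N).offDiag, eisensteinN N (p.1 - p.2) +
    Real.log (N / (2 * Real.pi * ‖ModularForm.eta Complex.I‖ ^ 2))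

/-- The expectation `𝔼 f⁺ - 𝔼 f⁻` with values in `[-∞, ∞]`
(by Mathlib's convention `∞ - ∞ = -∞`). -/
def extendedExpectation {Ω : Type*} [MeasurableSpace Ω] (P : Measure Ω) (f : Ω → ℝ) : EReal :=
  ((∫⁻ ω, ENNReal.ofReal (f ω) ∂P : ℝ≥0∞) : EReal) -
    ((∫⁻ ω, ENNReal.ofReal (-f ω) ∂P : ℝ≥0∞) : EReal)

end

/-! Let K(z) be the Eisenstein series at u + iv = z, let t(z) = (1-|Re z|)⁺(1-|Im z|)⁺ be the weight
`tent`, and let c = 2πη(i)². The energy sums a function of the difference over pairs, and the pairs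
in [0,N]² with difference v fill an area N² t(v/N). Hence, formally, E W_N = (1/2π) ∫ K(v/N) (1 -
T₂(v)) t(v/N) dv + log(N/c).

Two facts about K turn this into a usable formula. First, ∫ tK = 0
(`integral_tent_mul_kroneckerPlane`), so the Poisson part drops out. Second, the Kronecker limit
formula (`tendsto_squareSum`) gives K(z) = -2π log(c|z|) + R(z), where R tends to 0 at the origin
(`tendsto_kroneckerRem`) and tR is bounded (`exists_abs_tent_mul_kroneckerRem_le`). Substituting, E
W_N = ∫ t(v/N) log|v| T₂ + log(N/c) (1 - ∫ t(v/N) T₂) - (1/2π) ∫ t(v/N) R(v/N) T₂, provided log|v|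
T₂ is integrable. Otherwise, since K is bounded below, the expectation is +∞ for every N ≥ 2
(`extendedExpectation_renormalizedEnergy`).

By dominated convergence the first integral tends to ∫ log|v| T₂ and the last to 0. Since 1 - t(z) ≤
2|z|, the first moment of T₂ gives ∫ T₂ - ∫ t(v/N) T₂ = O(1/N), which beats the logarithm; so the
middle term is (1 - ∫ T₂) log(N/c) + o(1). Finally ∫ T₂ ≤ 1, because the number of points in [0,N]²
has nonnegative variance (`integral_tent_mul_le_one`). Thus ∫ T₂ ≠ 1 forces divergence to +∞, and ∫
T₂ = 1 leaves the logarithmic integral as the limit. -/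

/-! ### Characters and one-dimensional Fourier sums -/

/-- The character `x ↦ e^{2πix}`. -/
noncomputable def unitChar (x : ℝ) : ℂ := Complex.exp (2 * Real.pi * Complex.I * x)

lemma unitChar_add (x y : ℝ) : unitChar (x + y) = unitChar x * unitChar y := by
  simp [unitChar, ← Complex.exp_add]; ring_nf

lemma norm_unitChar (x : ℝ) : ‖unitChar x‖ = 1 := by
  rw [unitChar, show (2 * Real.pi * Complex.I * x : ℂ) = ((2 * Real.pi * x : ℝ) : ℂ) * Complex.I by
    push_cast; ring, Complex.norm_exp_ofReal_mul_I]

lemma unitChar_nat_mul (n : ℕ) (x : ℝ) : unitChar (n * x) = unitChar x ^ n := by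
  rw [unitChar, unitChar, ← Complex.exp_nat_mul]; push_cast; ring_nf

lemma fourier_eq_unitChar (n : ℤ) (x : ℝ) :
    fourier n (x : AddCircle (1 : ℝ)) = unitChar (n * x) := by
  rw [fourier_coe_apply, unitChar]; push_cast; ring_nf

lemma re_unitChar (x : ℝ) : (unitChar x).re = Real.cos (2 * Real.pi * x) := by
  rw [unitChar, show (2 * Real.pi * Complex.I * x : ℂ) = ((2 * Real.pi * x : ℝ) : ℂ) * Complex.I by
    push_cast; ring, Complex.exp_ofReal_mul_I_re]

lemma unitChar_add_unitChar_neg (x : ℝ) :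
    unitChar x + unitChar (-x) = ((2 * Real.cos (2 * Real.pi * x) : ℝ) : ℂ) := by
  rw [unitChar, unitChar]; push_cast; rw [Complex.two_cos]; ring_nf

/-- The sum of `e^{2πinv} / (a² + n²)` over the integers `n`, for `0 ≤ v < 1`. -/
noncomputable def expKernel (a v : ℝ) : ℝ :=
  Real.pi / a * ((Real.exp (-2 * Real.pi * a * v) + Real.exp (-2 * Real.pi * a * (1 - v))) /
    (1 - Real.exp (-2 * Real.pi * a)))

lemma summable_inv_sq_add_sq (a : ℝ) : Summable fun n : ℤ => (a ^ 2 + (n : ℝ) ^ 2)⁻¹ := by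
  refine Summable.of_norm_bounded_eventually (g := fun n : ℤ => 1 / (n : ℝ) ^ 2)
    (Real.summable_one_div_int_pow.mpr one_lt_two) ?_
  rw [Filter.eventually_cofinite]
  refine (Set.finite_singleton (0 : ℤ)).subset fun n hn => ?_
  by_contra h
  apply hn
  have h' : (n : ℝ) ≠ 0 := by exact_mod_cast h
  have : 0 < (n : ℝ) ^ 2 := by positivity
  rw [Real.norm_of_nonneg (by positivity), one_div]
  exact inv_anti₀ this (by nlinarith [sq_nonneg a])

lemma integral_fourier_mul_exp (a : ℝ) (ha : 0 < a) (n : ℤ) :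
    ∫ x in (0 : ℝ)..1, Complex.exp (-(2 * Real.pi * Complex.I * n * x)) *
      ((Real.exp (-2 * Real.pi * a * x) + Real.exp (-2 * Real.pi * a * (1 - x)) : ℝ) : ℂ) =
      ((1 - Real.exp (-2 * Real.pi * a)) * (a / Real.pi * (a ^ 2 + (n : ℝ) ^ 2)⁻¹) : ℝ) := by
  have hpi : (Real.pi : ℂ) ≠ 0 := by exact_mod_cast Real.pi_ne_zero
  have h1 : (a + n * Complex.I : ℂ) ≠ 0 := fun h => by
    have := congrArg Complex.re h; simp at this; exact ha.ne' this
  have h2 : (a - n * Complex.I : ℂ) ≠ 0 := fun h => by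
    have := congrArg Complex.re h; simp at this; exact ha.ne' this
  set c₁ : ℂ := -(2 * Real.pi * (a + n * Complex.I)) with hc₁
  set c₂ : ℂ := 2 * Real.pi * (a - n * Complex.I) with hc₂
  have hc₁0 : c₁ ≠ 0 := by simp [hc₁, hpi, h1]
  have hc₂0 : c₂ ≠ 0 := by simp [hc₂, hpi, h2]
  set q : ℂ := Complex.exp (-(2 * Real.pi * a)) with hq
  -- The integer n disappears from both endpoint values, as e^{2πin} = 1.
  have e1 : Complex.exp c₁ = q := by
    rw [show c₁ = -(2 * Real.pi * a) + ((-n : ℤ) : ℂ) * (2 * Real.pi * Complex.I) by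
      push_cast; rw [hc₁]; ring, Complex.exp_add, Complex.exp_int_mul_two_pi_mul_I, mul_one]
  have e2 : q * Complex.exp c₂ = 1 := by
    rw [hq, ← Complex.exp_add, show -(2 * Real.pi * a : ℂ) + c₂ =
      ((-n : ℤ) : ℂ) * (2 * Real.pi * Complex.I) by push_cast; rw [hc₂]; ring,
      Complex.exp_int_mul_two_pi_mul_I]
  have hint : ∀ x : ℝ, Complex.exp (-(2 * Real.pi * Complex.I * n * x)) *
      ((Real.exp (-2 * Real.pi * a * x) + Real.exp (-2 * Real.pi * a * (1 - x)) : ℝ) : ℂ) =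
      Complex.exp (c₁ * x) + q * Complex.exp (c₂ * x) := by
    intro x
    push_cast
    rw [mul_add, ← Complex.exp_add, ← Complex.exp_add, hq, ← Complex.exp_add, hc₁, hc₂]
    congr 2 <;> ring
  simp_rw [hint]
  rw [intervalIntegral.integral_add (Continuous.intervalIntegrable (by fun_prop) _ _)
    (Continuous.intervalIntegrable (by fun_prop) _ _), intervalIntegral.integral_const_mul,
    integral_exp_mul_complex hc₁0, integral_exp_mul_complex hc₂0]
  simp only [Complex.ofReal_one, mul_one, Complex.ofReal_zero, mul_zero, Complex.exp_zero]
  rw [mul_div_assoc', mul_sub, e2, e1]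
  push_cast
  rw [show (-2 * Real.pi * a : ℂ) = -(2 * Real.pi * a) by ring, ← hq]
  have h3 : (a ^ 2 + n ^ 2 : ℂ) = (a + n * Complex.I) * (a - n * Complex.I) := by
    ring_nf; rw [Complex.I_sq]; ring
  rw [h3, hc₁, hc₂]
  field_simp
  ring

/-- Up to a constant factor, the right side is a function on [0,1] with equal endpoint values, hence
continuous on the circle. Its Fourier coefficients are proportional to 1/(a² + n²), so they are
summable and the Fourier series converges pointwise to it. -/
lemma hasSum_unitChar_mul_inv_sq_add_sq {a v : ℝ} (ha : 0 < a) (hv : v ∈ Set.Ico (0 : ℝ) 1) :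
    HasSum (fun n : ℤ => unitChar (n * v) * (((a ^ 2 + (n : ℝ) ^ 2)⁻¹ : ℝ) : ℂ))
      (expKernel a v) := by
  have : Fact ((0 : ℝ) < 1) := ⟨one_pos⟩
  set g : ℝ → ℂ := fun x =>
    ((Real.exp (-2 * Real.pi * a * x) + Real.exp (-2 * Real.pi * a * (1 - x)) : ℝ) : ℂ) with hg
  have hcont : Continuous (AddCircle.liftIco (1 : ℝ) 0 g) :=
    AddCircle.liftIco_zero_continuous (by simp [hg, add_comm]) (by fun_prop)
  let B : C(AddCircle (1 : ℝ), ℂ) := ⟨_, hcont⟩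
  set d : ℝ := (1 - Real.exp (-2 * Real.pi * a)) * (a / Real.pi) with hd
  have hd0 : 0 < d := by
    have : Real.exp (-2 * Real.pi * a) < 1 := by
      rw [Real.exp_lt_one_iff]; nlinarith [Real.pi_pos, mul_pos Real.pi_pos ha]
    have := Real.pi_pos
    exact mul_pos (by linarith) (by positivity)
  have hcoef : ∀ n : ℤ, fourierCoeff B n = ((d * (a ^ 2 + (n : ℝ) ^ 2)⁻¹ : ℝ) : ℂ) := by
    intro n
    change fourierCoeff (AddCircle.liftIco (1 : ℝ) 0 g) n = _
    rw [fourierCoeff_liftIco_eq, fourierCoeffOn_eq_integral]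
    have := integral_fourier_mul_exp a ha n
    simp only [zero_add, sub_zero, div_one, one_smul, smul_eq_mul]
    rw [hd, mul_assoc, ← this]
    refine intervalIntegral.integral_congr fun x _ => ?_
    simp only [hg]
    congr 1
    rw [fourier_coe_apply]
    push_cast
    congr 1
    ring
  have hsum : Summable (fourierCoeff B) := by
    refine Summable.congr ?_ fun n => (hcoef n).symm
    exact Complex.ofRealCLM.summable ((summable_inv_sq_add_sq a).mul_left d)
  have key := has_pointwise_sum_fourier_series_of_summable hsum (v : AddCircle (1 : ℝ))
  simp_rw [hcoef, fourier_eq_unitChar, smul_eq_mul] at key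
  have hBv : B (v : AddCircle (1 : ℝ)) = g v := by
    change AddCircle.liftIco (1 : ℝ) 0 g v = _
    rw [AddCircle.liftIco_coe_apply (by simpa using hv)]
  rw [hBv] at key
  have hd0' : (d : ℂ) ≠ 0 := by exact_mod_cast hd0.ne'
  convert! key.mul_left (d : ℂ)⁻¹ using 1
  · ext n
    push_cast
    field_simp
  · rw [hg, hd, expKernel]
    push_cast
    have := Real.pi_ne_zero
    field_simp

/-- This is the Fourier series of the Bernoulli polynomial B₂; the term n = 0 is zero because 0⁻¹ =
0. -/
lemma hasSum_unitChar_mul_inv_sq {v : ℝ} (hv : v ∈ Set.Icc (0 : ℝ) 1) :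
    HasSum (fun n : ℤ => unitChar (n * v) * ((((n : ℝ) ^ 2)⁻¹ : ℝ) : ℂ))
      ((2 * Real.pi ^ 2 * (v ^ 2 - v + 1 / 6) : ℝ) : ℂ) := by
  convert! hasSum_one_div_pow_mul_fourier_mul_bernoulliFun (le_refl 2) hv using 1
  · ext n
    rw [fourier_eq_unitChar]; push_cast; rw [one_div]; ring
  · rw [bernoulliFun_two]
    push_cast
    rw [mul_pow, Complex.I_sq]
    rw [show ((Nat.factorial 2 : ℕ) : ℂ) = 2 by norm_num [Nat.factorial]]
    ring

/-! ### Abel summation and convergence over squares -/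

lemma norm_sum_Ico_antitone_mul_pow_le {f : ℕ → ℝ} (hf : Antitone f) (hf0 : ∀ n, 0 ≤ f n) {z : ℂ}
    {B : ℝ} (hB : ∀ n, ‖∑ i ∈ Finset.range n, z ^ i‖ ≤ B) {a b : ℕ} (hab : a ≤ b) :
    ‖∑ i ∈ Finset.Ico a b, (f i : ℂ) * z ^ i‖ ≤ 2 * B * f a := by
  set s : ℕ → ℂ := fun n => ∑ i ∈ Finset.range n, z ^ i with hs
  have hdiff : ∀ n, ‖s n - s a‖ ≤ 2 * B := fun n =>
    (norm_sub_le _ _).trans (by linarith [hB n, hB a])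
  -- Abel summation: once the boundary term is removed, what remains is a sum of s - s a against the
  -- decrements of f, which telescope.
  have key : ‖∑ i ∈ Finset.Ico a b, (f i : ℂ) * z ^ i - f b * (s b - s a)‖ ≤
      2 * B * (f a - f b) := by
    induction b, hab using Nat.le_induction with
    | base => simp
    | succ b hab ih =>
      have e : ∑ i ∈ Finset.Ico a (b + 1), (f i : ℂ) * z ^ i - f (b + 1) * (s (b + 1) - s a) =
          (∑ i ∈ Finset.Ico a b, (f i : ℂ) * z ^ i - f b * (s b - s a)) +
            ((f b - f (b + 1) : ℝ) : ℂ) * (s (b + 1) - s a) := by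
        rw [Finset.sum_Ico_succ_top hab, show s (b + 1) = s b + z ^ b by
          simp only [hs, Finset.sum_range_succ]]
        push_cast
        ring
      have h1 : 0 ≤ f b - f (b + 1) := sub_nonneg.mpr (hf (Nat.le_succ b))
      rw [e]
      refine (norm_add_le _ _).trans ?_
      rw [norm_mul, Complex.norm_real, Real.norm_of_nonneg h1]
      nlinarith [mul_le_mul_of_nonneg_left (hdiff (b + 1)) h1]
  have h2 : ‖(f b : ℂ) * (s b - s a)‖ ≤ f b * (2 * B) := by
    rw [norm_mul, Complex.norm_real, Real.norm_of_nonneg (hf0 b)]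
    exact mul_le_mul_of_nonneg_left (hdiff b) (hf0 b)
  calc ‖∑ i ∈ Finset.Ico a b, (f i : ℂ) * z ^ i‖
      = ‖(∑ i ∈ Finset.Ico a b, (f i : ℂ) * z ^ i - f b * (s b - s a)) + f b * (s b - s a)‖ := by
        rw [sub_add_cancel]
    _ ≤ 2 * B * (f a - f b) + f b * (2 * B) := (norm_add_le _ _).trans (add_le_add key h2)
    _ = 2 * B * f a := by ring

lemma unitChar_ne_one {v : ℝ} (hv : v ∈ Set.Ioo (0 : ℝ) 1) : unitChar v ≠ 1 := by
  intro h
  rw [unitChar, Complex.exp_eq_one_iff] at h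
  obtain ⟨n, hn⟩ := h
  have h1 : (v : ℂ) = n := by
    have h2 : (2 * Real.pi * Complex.I : ℂ) ≠ 0 := Complex.two_pi_I_ne_zero
    apply mul_left_cancel₀ h2
    rw [hn]; ring
  have h3 : v = n := by exact_mod_cast h1
  have h4 : (0 : ℝ) < n := h3 ▸ hv.1
  have h5 : (n : ℝ) < 1 := h3 ▸ hv.2
  norm_cast at h4 h5
  omega

lemma norm_geom_sum_le {z : ℂ} (hz : ‖z‖ = 1) (h1 : z ≠ 1) (n : ℕ) :
    ‖∑ i ∈ Finset.range n, z ^ i‖ ≤ 2 / ‖z - 1‖ := by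
  rw [geom_sum_eq h1, norm_div]
  gcongr
  refine (norm_sub_le _ _).trans ?_
  rw [norm_pow, hz]; norm_num

lemma sum_Icc_neg_eq {f : ℤ → ℂ} (M : ℕ) :
    ∑ n ∈ Finset.Icc (-(M : ℤ)) M, f n =
      f 0 + ∑ n ∈ Finset.range M, (f (n + 1) + f (-(n + 1))) := by
  induction M with
  | zero => simp
  | succ M ih =>
    rw [Nat.cast_add, Nat.cast_one, Finset.sum_Icc_succ_eq_add_endpoints, ih,
      Finset.sum_range_succ]
    ring

/-- Oscillation improves the trivial tail O(1/M) to O(1/M²), uniformly in `a`. The uniformity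
matters because 2M + 1 columns are truncated at once. -/
lemma norm_hasSum_sub_sum_Icc_le {v : ℝ} (hv : v ∈ Set.Ioo (0 : ℝ) 1) (a : ℝ) {C : ℂ}
    (hC : HasSum (fun n : ℤ => unitChar (n * v) * (((a ^ 2 + (n : ℝ) ^ 2)⁻¹ : ℝ) : ℂ)) C)
    (M : ℕ) :
    ‖C - ∑ n ∈ Finset.Icc (-(M : ℤ)) M,
        unitChar (n * v) * (((a ^ 2 + (n : ℝ) ^ 2)⁻¹ : ℝ) : ℂ)‖ ≤
      4 * (2 / ‖unitChar v - 1‖ + 2 / ‖unitChar (-v) - 1‖) * (((M : ℝ) + 1) ^ 2)⁻¹ := by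
  set g : ℤ → ℂ := fun n => unitChar (n * v) * (((a ^ 2 + (n : ℝ) ^ 2)⁻¹ : ℝ) : ℂ) with hg
  set B₁ := 2 / ‖unitChar v - 1‖
  set B₂ := 2 / ‖unitChar (-v) - 1‖
  have hB₁ : 0 ≤ B₁ := by positivity
  have hB₂ : 0 ≤ B₂ := by positivity
  have hneg : unitChar (-v) ≠ 1 := by
    intro h
    apply unitChar_ne_one hv
    have := unitChar_add v (-v)
    rw [h, mul_one, add_neg_cancel] at this
    rw [← this]; simp [unitChar]
  set f : ℕ → ℝ := fun n => (a ^ 2 + ((n : ℝ) + 1) ^ 2)⁻¹ with hf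
  have hf0 : ∀ n, 0 ≤ f n := fun n => by positivity
  have hfanti : Antitone f := by
    intro m n hmn
    have : (m : ℝ) ≤ n := by exact_mod_cast hmn
    simp only [hf]
    gcongr
  have hgpos : ∀ n : ℕ, g (n + 1) = unitChar v * ((f n : ℂ) * unitChar v ^ n) := by
    intro n
    have : (((n : ℤ) + 1 : ℤ) : ℝ) * v = v + n * v := by push_cast; ring
    simp only [hg, hf]
    rw [this, unitChar_add, unitChar_nat_mul]
    push_cast
    ring
  have hgneg : ∀ n : ℕ, g (-(n + 1)) = unitChar (-v) * ((f n : ℂ) * unitChar (-v) ^ n) := by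
    intro n
    have : ((-((n : ℤ) + 1) : ℤ) : ℝ) * v = -v + n * (-v) := by push_cast; ring
    simp only [hg, hf]
    rw [this, unitChar_add, unitChar_nat_mul]
    push_cast
    ring_nf
  have hlim : Tendsto (fun K : ℕ => ∑ n ∈ Finset.Icc (-(K : ℤ)) K, g n) atTop (𝓝 C) :=
    by
    rw [HasSum, SummationFilter.unconditional_filter] at hC
    exact hC.comp Finset.tendsto_Icc_neg
  refine le_of_tendsto ((hlim.sub_const _).norm) ?_
  filter_upwards [eventually_ge_atTop M] with K hK
  rw [sum_Icc_neg_eq, sum_Icc_neg_eq, add_sub_add_left_eq_sub, ← Finset.sum_Ico_eq_sub _ hK,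
    Finset.sum_add_distrib]
  simp_rw [hgpos, hgneg, ← Finset.mul_sum]
  refine (norm_add_le _ _).trans ?_
  rw [norm_mul, norm_mul, norm_unitChar, norm_unitChar, one_mul, one_mul]
  have h1 := norm_sum_Ico_antitone_mul_pow_le hfanti hf0
    (norm_geom_sum_le (norm_unitChar v) (unitChar_ne_one hv)) hK
  have h2 := norm_sum_Ico_antitone_mul_pow_le hfanti hf0
    (norm_geom_sum_le (norm_unitChar (-v)) hneg) hK
  have h3 : f M ≤ (((M : ℝ) + 1) ^ 2)⁻¹ := by
    simp only [hf]
    gcongr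
    nlinarith [sq_nonneg a]
  have h4 : 0 ≤ (((M : ℝ) + 1) ^ 2)⁻¹ := by positivity
  calc _ ≤ 2 * B₁ * f M + 2 * B₂ * f M := add_le_add h1 h2
    _ = 2 * (B₁ + B₂) * f M := by ring
    _ ≤ 2 * (B₁ + B₂) * (((M : ℝ) + 1) ^ 2)⁻¹ := by gcongr
    _ ≤ _ := by nlinarith [mul_nonneg (add_nonneg hB₁ hB₂) h4]

/-- The sum of `e^{2πinv} / (m² + n²)` over the integers `n` (`n ≠ 0` if `m = 0`). -/
noncomputable def columnSum (v : ℝ) (m : ℤ) : ℝ :=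
  if m = 0 then 2 * Real.pi ^ 2 * (v ^ 2 - v + 1 / 6) else expKernel |(m : ℝ)| v

lemma hasSum_columnSum {v : ℝ} (hv : v ∈ Set.Ioo (0 : ℝ) 1) (m : ℤ) :
    HasSum (fun n : ℤ => unitChar (n * v) * ((((m : ℝ) ^ 2 + (n : ℝ) ^ 2)⁻¹ : ℝ) : ℂ))
      (columnSum v m) := by
  by_cases hm : m = 0
  · simpa [columnSum, hm] using hasSum_unitChar_mul_inv_sq (Set.Ioo_subset_Icc_self hv)
  · have := hasSum_unitChar_mul_inv_sq_add_sq (a := |(m : ℝ)|) (by positivity)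
      (Set.Ioo_subset_Ico_self hv)
    simpa [columnSum, hm, sq_abs] using this

/-- Partial sums over squares of `e^{2πi(mu+nv)} / (m² + n²)`. -/
noncomputable def squareSum (u v : ℝ) (M : ℕ) : ℂ :=
  ∑ m ∈ Finset.Icc (-(M : ℤ)) M, unitChar (m * u) *
    ∑ n ∈ Finset.Icc (-(M : ℤ)) M, unitChar (n * v) * ((((m : ℝ) ^ 2 + (n : ℝ) ^ 2)⁻¹ : ℝ) : ℂ)

lemma eisensteinUV_I_eq (u v : ℝ) :
    eisensteinUV u v Complex.I = limUnder atTop (squareSum u v) := by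
  rw [eisensteinUV]
  congr 1
  ext M
  have h0 : ∀ p : ℤ × ℤ, Complex.exp (2 * Real.pi * Complex.I * (p.1 * u + p.2 * v)) *
        ((Complex.I.im / ‖(p.1 : ℂ) * Complex.I + p.2‖ ^ 2 : ℝ) : ℂ) =
      unitChar (p.1 * u) * (unitChar (p.2 * v) *
        ((((p.1 : ℝ) ^ 2 + (p.2 : ℝ) ^ 2)⁻¹ : ℝ) : ℂ)) := by
    intro p
    have : ‖(p.1 : ℂ) * Complex.I + p.2‖ ^ 2 = (p.1 : ℝ) ^ 2 + (p.2 : ℝ) ^ 2 := by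
      rw [← Complex.normSq_eq_norm_sq, Complex.normSq_apply]
      simp
      ring
    rw [this, ← mul_assoc, ← unitChar_add, unitChar, Complex.I_im, one_div]
    push_cast
    ring_nf
  simp_rw [h0]
  -- The origin may be put back, since its term is 0⁻¹ = 0.
  rw [Finset.sum_erase _ (by simp), Finset.sum_product, squareSum]
  simp_rw [Finset.mul_sum]

/-- Completing each of the 2M + 1 columns costs O(1/M²), so the total error is O(1/M). This reduces
the conditionally convergent double sum to a single sum over columns. -/
lemma tendsto_squareSum_sub {v : ℝ} (hv : v ∈ Set.Ioo (0 : ℝ) 1) (u : ℝ) :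
    Tendsto (fun M : ℕ => ∑ m ∈ Finset.Icc (-(M : ℤ)) M, unitChar (m * u) * (columnSum v m : ℂ) -
      squareSum u v M) atTop (𝓝 0) := by
  set B := 4 * (2 / ‖unitChar v - 1‖ + 2 / ‖unitChar (-v) - 1‖)
  have hB : 0 ≤ B := by positivity
  have hlim : Tendsto (fun M : ℕ => 2 * B * (1 / ((M : ℝ) + 1))) atTop (𝓝 0) := by
    simpa using tendsto_one_div_add_atTop_nhds_zero_nat.const_mul (2 * B)
  refine squeeze_zero_norm (fun M => ?_) hlim
  rw [squareSum, ← Finset.sum_sub_distrib]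
  calc _ ≤ ∑ m ∈ Finset.Icc (-(M : ℤ)) M, B * (((M : ℝ) + 1) ^ 2)⁻¹ := by
        refine norm_sum_le_of_le _ fun m _ => ?_
        rw [← mul_sub, norm_mul, norm_unitChar, one_mul]
        exact norm_hasSum_sub_sum_Icc_le hv m (hasSum_columnSum hv m) M
    _ = (2 * (M : ℝ) + 1) * (B * (((M : ℝ) + 1) ^ 2)⁻¹) := by
        rw [Finset.sum_const, Int.card_Icc, nsmul_eq_mul]
        congr 1
        have : ((M : ℤ) + 1 - -(M : ℤ)).toNat = 2 * M + 1 := by omega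
        rw [this]; push_cast; ring
    _ ≤ (2 * ((M : ℝ) + 1)) * (B * (((M : ℝ) + 1) ^ 2)⁻¹) := by gcongr; linarith
    _ = 2 * B * (1 / ((M : ℝ) + 1)) := by field_simp

/-! ### The second Kronecker limit formula -/

/-- `log |1 - e^{2πi(u+iv)}|`. -/
noncomputable def logKernel (u v : ℝ) : ℝ :=
  Real.log ‖1 - unitChar u * Real.exp (-2 * Real.pi * v)‖

/-- The general term of the smooth part of the Kronecker limit formula. -/
noncomputable def kroneckerTailTerm (u v : ℝ) (m : ℕ) : ℝ :=
  Real.cos (2 * Real.pi * ((m + 1) * u)) *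
    (Real.exp (-2 * Real.pi * (m + 1) * v) + Real.exp (-2 * Real.pi * (m + 1) * (1 - v))) /
      ((m + 1) * (Real.exp (2 * Real.pi * (m + 1)) - 1))

/-- The smooth part of the Kronecker limit formula. -/
noncomputable def kroneckerTail (u v : ℝ) : ℝ := ∑' m, kroneckerTailTerm u v m

/-- The value of the Eisenstein series `E_{u,v}(i)` for `0 < v < 1`, by the second Kronecker limit
formula. -/
noncomputable def kronecker (u v : ℝ) : ℝ :=
  2 * Real.pi ^ 2 * (v ^ 2 - v + 1 / 6) - 2 * Real.pi * logKernel u v -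
    2 * Real.pi * logKernel u (1 - v) + 2 * Real.pi * kroneckerTail u v

lemma exp_le_exp_two_pi_mul_sub_one {x : ℝ} (hx : 1 ≤ x) :
    Real.exp x ≤ Real.exp (2 * Real.pi * x) - 1 := by
  have h1 : Real.exp (2 * x) ≤ Real.exp (2 * Real.pi * x) := by
    apply Real.exp_le_exp.mpr
    nlinarith [Real.pi_gt_three]
  have h2 : Real.exp (2 * x) = Real.exp x * Real.exp x := by rw [← Real.exp_add]; ring_nf
  have h3 : x + 1 ≤ Real.exp x := Real.add_one_le_exp x
  nlinarith

lemma norm_kroneckerTailTerm_le (u : ℝ) {v : ℝ} (hv : v ∈ Set.Icc (0 : ℝ) 1) (m : ℕ) :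
    ‖kroneckerTailTerm u v m‖ ≤ 2 * Real.exp (-1) ^ (m + 1) := by
  have hm : (1 : ℝ) ≤ (m : ℝ) + 1 := by linarith [(Nat.cast_nonneg m : (0 : ℝ) ≤ m)]
  have h1 := exp_le_exp_two_pi_mul_sub_one hm
  have hpos := Real.exp_pos ((m : ℝ) + 1)
  have hpi := Real.pi_pos
  have e1 : Real.exp (-2 * Real.pi * (m + 1) * v) ≤ 1 := by
    rw [Real.exp_le_one_iff]
    have : 0 ≤ Real.pi * (m + 1) * v := mul_nonneg (by positivity) hv.1
    linarith
  have e2 : Real.exp (-2 * Real.pi * (m + 1) * (1 - v)) ≤ 1 := by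
    rw [Real.exp_le_one_iff]
    have : 0 ≤ Real.pi * (m + 1) * (1 - v) := mul_nonneg (by positivity) (by linarith [hv.2])
    linarith
  have e3 : Real.exp (-1) ^ (m + 1) = (Real.exp ((m : ℝ) + 1))⁻¹ := by
    rw [← Real.exp_nat_mul, ← Real.exp_neg]; push_cast; ring_nf
  rw [kroneckerTailTerm, norm_div, norm_mul, e3, ← div_eq_mul_inv]
  have h2 : Real.exp ((m : ℝ) + 1) ≤
      ‖((m : ℝ) + 1) * (Real.exp (2 * Real.pi * (m + 1)) - 1)‖ := by
    rw [Real.norm_of_nonneg (mul_nonneg (by linarith) (by linarith))]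
    nlinarith
  have h3 := Real.abs_cos_le_one (2 * Real.pi * ((m + 1) * u))
  rw [Real.norm_of_nonneg (by positivity : 0 ≤ Real.exp (-2 * Real.pi * (m + 1) * v) +
    Real.exp (-2 * Real.pi * (m + 1) * (1 - v)))]
  have h4 : ‖Real.cos (2 * Real.pi * ((m + 1) * u))‖ * (Real.exp (-2 * Real.pi * (m + 1) * v) +
      Real.exp (-2 * Real.pi * (m + 1) * (1 - v))) ≤ 1 * 2 :=
    mul_le_mul h3 (by linarith) (by positivity) zero_le_one
  rw [one_mul] at h4
  exact div_le_div₀ zero_le_two h4 hpos h2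

lemma summable_two_mul_exp_neg_one_pow : Summable fun m : ℕ => 2 * Real.exp (-1) ^ (m + 1) :=
  ((summable_nat_add_iff 1).mpr (summable_geometric_of_lt_one (Real.exp_nonneg _)
    (Real.exp_lt_one_iff.mpr (by norm_num)))).mul_left 2

lemma hasSum_kroneckerTail (u : ℝ) {v : ℝ} (hv : v ∈ Set.Icc (0 : ℝ) 1) :
    HasSum (kroneckerTailTerm u v) (kroneckerTail u v) :=
  (Summable.of_norm_bounded summable_two_mul_exp_neg_one_pow
    (norm_kroneckerTailTerm_le u hv)).hasSum

/-- Real part of the Taylor series of -log(1 - z) at z = e^{2πi(u+iv)}, with the vanishing zeroth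
term shifted away. -/
lemma hasSum_logKernel (u : ℝ) {v : ℝ} (hv : 0 < v) :
    HasSum (fun m : ℕ => Real.cos (2 * Real.pi * ((m + 1) * u)) *
      Real.exp (-2 * Real.pi * (m + 1) * v) / (m + 1)) (-logKernel u v) := by
  set z : ℂ := unitChar u * Real.exp (-2 * Real.pi * v) with hz
  have hz1 : ‖z‖ < 1 := by
    rw [hz, norm_mul, norm_unitChar, one_mul, Complex.norm_real,
      Real.norm_of_nonneg (Real.exp_nonneg _), Real.exp_lt_one_iff]
    nlinarith [mul_pos Real.pi_pos hv]
  have h := (hasSum_nat_add_iff' 1).mpr (Complex.hasSum_re (Complex.hasSum_taylorSeries_neg_log hz1))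
  simp only [Finset.sum_range_one, pow_zero, Nat.cast_zero, div_zero, Complex.zero_re, sub_zero,
    Complex.neg_re, Complex.log_re] at h
  convert! h using 1
  ext m
  rw [hz, mul_pow, ← unitChar_nat_mul, ← Complex.ofReal_pow, ← Real.exp_nat_mul,
    show ((m + 1 : ℕ) : ℂ) = (((m + 1 : ℕ) : ℝ) : ℂ) by push_cast; rfl, Complex.div_ofReal_re,
    Complex.re_mul_ofReal, re_unitChar]
  push_cast
  ring_nf

/-- With Q = e^{2π(m+1)}, write (1 - Q⁻¹)⁻¹ = 1 + (Q - 1)⁻¹. The summand 1 produces the two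
logarithms, at v and at 1 - v, and (Q - 1)⁻¹ produces the rapidly convergent tail. -/
lemma hasSum_cos_mul_expKernel (u : ℝ) {v : ℝ} (hv : v ∈ Set.Ioo (0 : ℝ) 1) :
    HasSum (fun m : ℕ => 2 * Real.cos (2 * Real.pi * ((m + 1) * u)) * expKernel (m + 1) v)
      (kronecker u v - 2 * Real.pi ^ 2 * (v ^ 2 - v + 1 / 6)) := by
  have h := (((hasSum_logKernel u hv.1).add
    (hasSum_logKernel u (sub_pos.mpr hv.2))).add
      (hasSum_kroneckerTail u (Set.Ioo_subset_Icc_self hv))).mul_left (2 * Real.pi)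
  convert! h using 1
  · ext m
    have hm : (1 : ℝ) ≤ (m : ℝ) + 1 := by linarith [(Nat.cast_nonneg m : (0 : ℝ) ≤ m)]
    have h1 := exp_le_exp_two_pi_mul_sub_one hm
    have hpos := Real.exp_pos ((m : ℝ) + 1)
    set Q := Real.exp (2 * Real.pi * (m + 1)) with hQ
    have hQ1 : Q - 1 ≠ 0 := by linarith
    have hQ0 : Q ≠ 0 := (Real.exp_pos _).ne'
    have e : Real.exp (-2 * Real.pi * (m + 1)) = Q⁻¹ := by rw [hQ, ← Real.exp_neg]; ring_nf
    have e2 : 1 - Q⁻¹ ≠ 0 := by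
      rw [show 1 - Q⁻¹ = (Q - 1) / Q by field_simp]
      positivity
    rw [expKernel, kroneckerTailTerm, e, ← hQ]
    set A := Real.exp (-2 * Real.pi * (m + 1) * v)
    set A' := Real.exp (-2 * Real.pi * (m + 1) * (1 - v))
    set c := Real.cos (2 * Real.pi * ((m + 1) * u))
    have e3 : (1 - Q⁻¹)⁻¹ = 1 + (Q - 1)⁻¹ := by
      field_simp
      ring
    rw [div_eq_mul_inv (A + A'), e3]
    field_simp
  · rw [kronecker]; ring

lemma tendsto_squareSum {v : ℝ} (hv : v ∈ Set.Ioo (0 : ℝ) 1) (u : ℝ) :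
    Tendsto (squareSum u v) atTop (𝓝 (kronecker u v : ℂ)) := by
  have h1 := ((hasSum_cos_mul_expKernel u hv).tendsto_sum_nat).const_add
    (2 * Real.pi ^ 2 * (v ^ 2 - v + 1 / 6))
  rw [add_sub_cancel] at h1
  have h2 : Tendsto (fun M : ℕ => ∑ m ∈ Finset.Icc (-(M : ℤ)) M,
      unitChar (m * u) * (columnSum v m : ℂ)) atTop (𝓝 (kronecker u v : ℂ)) := by
    refine ((Complex.continuous_ofReal.tendsto _).comp h1).congr fun M => ?_
    rw [sum_Icc_neg_eq, Function.comp_apply, Complex.ofReal_add, Complex.ofReal_sum]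
    congr 1
    · simp [columnSum, unitChar]
    · refine Finset.sum_congr rfl fun m _ => ?_
      have e1 : columnSum v ((m : ℤ) + 1) = expKernel (m + 1) v := by
        rw [columnSum, if_neg (by omega)]
        push_cast
        rw [abs_of_nonneg (by positivity)]
      have e2 : columnSum v (-((m : ℤ) + 1)) = expKernel (m + 1) v := by
        rw [columnSum, if_neg (by omega)]
        push_cast
        rw [abs_neg, abs_of_nonneg (by positivity)]
      rw [e1, e2, ← add_mul]
      push_cast
      rw [neg_mul, unitChar_add_unitChar_neg]
      push_cast
      rfl
  simpa using h2.sub (tendsto_squareSum_sub hv u)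

lemma squareSum_neg (u v : ℝ) (M : ℕ) : squareSum (-u) (-v) M = squareSum u v M := by
  have hneg : ∀ f : ℤ → ℂ, ∑ m ∈ Finset.Icc (-(M : ℤ)) M, f (-m) =
      ∑ m ∈ Finset.Icc (-(M : ℤ)) M, f m := by
    intro f
    refine Finset.sum_nbij' (fun m => -m) (fun m => -m) ?_ ?_ ?_ ?_ ?_ <;>
      simp only [Finset.mem_Icc] <;> intros <;> first | omega | rfl | simp
  rw [squareSum, squareSum, ← hneg]
  refine Finset.sum_congr rfl fun m _ => ?_
  rw [← hneg]
  simp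

lemma logKernel_neg (u v : ℝ) : logKernel (-u) v = logKernel u v := by
  have h : unitChar (-u) = (starRingEnd ℂ) (unitChar u) := by
    rw [unitChar, unitChar, ← Complex.exp_conj]
    simp [Complex.conj_ofNat]
  have h2 : 1 - unitChar (-u) * Real.exp (-2 * Real.pi * v) =
      (starRingEnd ℂ) (1 - unitChar u * Real.exp (-2 * Real.pi * v)) := by
    rw [map_sub, map_mul, Complex.conj_ofReal, map_one, h]
  rw [logKernel, logKernel, h2, Complex.norm_conj]

lemma kronecker_neg (u v : ℝ) : kronecker (-u) v = kronecker u v := by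
  simp only [kronecker, logKernel_neg, kroneckerTail, kroneckerTailTerm, mul_neg, Real.cos_neg]

/-- For negative v, the symmetry (m, n) ↦ (-m, -n) of the square sums passes to (-u, |v|), and the
limit function is even in u. -/
lemma eisensteinUV_re_eq {u v : ℝ} (hv0 : v ≠ 0) (hv1 : |v| < 1) :
    (eisensteinUV u v Complex.I).re = kronecker u |v| := by
  rw [eisensteinUV_I_eq]
  have hv : |v| ∈ Set.Ioo (0 : ℝ) 1 := ⟨abs_pos.mpr hv0, hv1⟩
  rcases abs_choice v with h | h
  · rw [(tendsto_squareSum (h ▸ hv) u).limUnder_eq, h, Complex.ofReal_re]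
  · have h2 : squareSum u v = squareSum (-u) |v| := by
      ext M; rw [← squareSum_neg, h]
    rw [h2, (tendsto_squareSum hv (-u)).limUnder_eq, Complex.ofReal_re, kronecker_neg]

/-! ### Bounds for the logarithmic kernel -/

lemma norm_one_sub_le_two (u : ℝ) {v : ℝ} (hv : 0 ≤ v) :
    ‖1 - unitChar u * Real.exp (-2 * Real.pi * v)‖ ≤ 2 := by
  refine (norm_sub_le _ _).trans ?_
  rw [norm_mul, norm_unitChar, Complex.norm_real, Real.norm_of_nonneg (Real.exp_nonneg _), norm_one]
  have : Real.exp (-2 * Real.pi * v) ≤ 1 := by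
    rw [Real.exp_le_one_iff]
    nlinarith [mul_nonneg Real.pi_pos.le hv]
  linarith

lemma logKernel_le_log_two (u : ℝ) {v : ℝ} (hv : 0 ≤ v) : logKernel u v ≤ Real.log 2 := by
  rw [logKernel]
  rcases (norm_nonneg (1 - unitChar u * Real.exp (-2 * Real.pi * v))).eq_or_lt with h | h
  · rw [← h, Real.log_zero]; exact Real.log_nonneg one_le_two
  · exact Real.log_le_log h (norm_one_sub_le_two u hv)

lemma half_le_norm_one_sub (u : ℝ) {v : ℝ} (hv : v ∈ Set.Icc (0 : ℝ) 1) :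
    v / 2 ≤ ‖1 - unitChar u * Real.exp (-2 * Real.pi * v)‖ := by
  have hx : 0 ≤ 2 * Real.pi * v := mul_nonneg (by positivity) hv.1
  have h1 : Real.exp (-2 * Real.pi * v) ≤ 1 / (1 + 2 * Real.pi * v) := by
    rw [show -2 * Real.pi * v = -(2 * Real.pi * v) by ring, Real.exp_neg, one_div]
    exact inv_anti₀ (by positivity) (by linarith [Real.add_one_le_exp (2 * Real.pi * v)])
  have h2 : v / 2 ≤ 1 - 1 / (1 + 2 * Real.pi * v) := by
    rw [show 1 - 1 / (1 + 2 * Real.pi * v) = 2 * Real.pi * v / (1 + 2 * Real.pi * v) by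
      field_simp; ring, div_le_div_iff₀ two_pos (by positivity)]
    nlinarith [hv.1, hv.2, Real.pi_gt_three, mul_nonneg hv.1 (sub_nonneg.mpr hv.2),
      mul_nonneg (mul_nonneg hv.1 (sub_nonneg.mpr hv.2)) Real.pi_pos.le,
      mul_nonneg hv.1 Real.pi_pos.le, mul_nonneg hv.1 (sub_nonneg.mpr Real.pi_gt_three.le)]
  have h3 := norm_sub_norm_le (1 : ℂ) (unitChar u * Real.exp (-2 * Real.pi * v))
  rw [norm_mul, norm_unitChar, Complex.norm_real, Real.norm_of_nonneg (Real.exp_nonneg _), norm_one,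
    one_mul] at h3
  linarith

lemma im_unitChar (x : ℝ) : (unitChar x).im = Real.sin (2 * Real.pi * x) := by
  rw [unitChar, show (2 * Real.pi * Complex.I * x : ℂ) = ((2 * Real.pi * x : ℝ) : ℂ) * Complex.I by
    push_cast; ring, Complex.exp_ofReal_mul_I_im]

lemma norm_one_sub_sq (u v : ℝ) :
    ‖1 - unitChar u * Real.exp (-2 * Real.pi * v)‖ ^ 2 =
      (1 - Real.exp (-2 * Real.pi * v)) ^ 2 +
        4 * Real.exp (-2 * Real.pi * v) * Real.sin (Real.pi * u) ^ 2 := by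
  rw [← Complex.normSq_eq_norm_sq, Complex.normSq_apply, Complex.sub_re, Complex.sub_im,
    Complex.re_mul_ofReal, Complex.im_mul_ofReal, re_unitChar, im_unitChar, Complex.one_re,
    Complex.one_im, show 2 * Real.pi * u = 2 * (Real.pi * u) by ring, Real.cos_two_mul,
    Real.sin_two_mul]
  have h := Real.sin_sq_add_cos_sq (Real.pi * u)
  set s := Real.sin (Real.pi * u)
  set c := Real.cos (Real.pi * u)
  set r := Real.exp (-2 * Real.pi * v)
  linear_combination (4 * r ^ 2 * c ^ 2 - 4 * r) * h

lemma mul_one_sub_le_abs_sin {u : ℝ} (hu : |u| ≤ 1) :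
    2 * (|u| * (1 - |u|)) ≤ |Real.sin (Real.pi * u)| := by
  have hpi := Real.pi_pos
  have h0 := abs_nonneg u
  have e : |Real.sin (Real.pi * u)| = Real.sin (Real.pi * |u|) := by
    rcases abs_choice u with h | h
    · have : 0 ≤ Real.sin (Real.pi * |u|) :=
        Real.sin_nonneg_of_nonneg_of_le_pi (by positivity) (by nlinarith)
      rw [h] at this ⊢; exact abs_of_nonneg this
    · have : 0 ≤ Real.sin (Real.pi * |u|) :=
        Real.sin_nonneg_of_nonneg_of_le_pi (by positivity) (by nlinarith)
      rw [h] at this ⊢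
      rw [mul_neg, Real.sin_neg] at this ⊢
      exact abs_of_nonpos (by linarith)
  rw [e]
  set x := |u|
  rcases le_total x (1 / 2) with h | h
  · have := Real.mul_le_sin (x := Real.pi * x) (by positivity) (by nlinarith)
    rw [show 2 / Real.pi * (Real.pi * x) = 2 * x by field_simp] at this
    nlinarith
  · have := Real.mul_le_sin (x := Real.pi * (1 - x)) (mul_nonneg hpi.le (by linarith)) (by nlinarith)
    rw [show 2 / Real.pi * (Real.pi * (1 - x)) = 2 * (1 - x) by field_simp,
      show Real.pi * (1 - x) = Real.pi - Real.pi * x by ring, Real.sin_pi_sub] at this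
    nlinarith

/-- By periodicity the right side also vanishes at z = ±1, which is why the factor 1 - |Re z| is
needed. The modulus of the exponential controls |Im z|, and the sine in `norm_one_sub_sq` controls
|Re z|. -/
lemma mul_norm_le_norm_one_sub {z : ℂ} (hu : |z.re| ≤ 1) (hv : |z.im| ≤ 1) :
    Real.exp (-Real.pi) / 2 * ((1 - |z.re|) * ‖z‖) ≤
      ‖1 - unitChar z.re * Real.exp (-2 * Real.pi * |z.im|)‖ := by
  set D := ‖1 - unitChar z.re * Real.exp (-2 * Real.pi * |z.im|)‖ with hD
  have hpi := Real.pi_gt_three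
  have h1 : |z.im| / 2 ≤ D := half_le_norm_one_sub z.re ⟨abs_nonneg _, hv⟩
  have hc : Real.exp (-Real.pi) ≤ 1 / 2 := by
    rw [Real.exp_neg, one_div]
    exact inv_anti₀ two_pos (by linarith [Real.add_one_le_exp Real.pi])
  have hc0 := Real.exp_pos (-Real.pi)
  -- Chosen so that c² = e^{-2π} is below e^{-2π|Im z|} throughout |Im z| ≤ 1.
  set c := Real.exp (-Real.pi) with hcdef
  have h2 : c * (|z.re| * (1 - |z.re|)) ≤ D := by
    have hr : c ^ 2 ≤ Real.exp (-2 * Real.pi * |z.im|) := by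
      rw [hcdef, ← Real.exp_nat_mul]
      apply Real.exp_le_exp.mpr
      push_cast
      nlinarith
    have hs := mul_one_sub_le_abs_sin hu
    have h0 : 0 ≤ |z.re| * (1 - |z.re|) := mul_nonneg (abs_nonneg _) (by linarith)
    refine abs_le_of_sq_le_sq' ?_ (norm_nonneg _) |>.2
    rw [norm_one_sub_sq, ← sq_abs (Real.sin _), mul_pow]
    have h3 : (|z.re| * (1 - |z.re|)) ^ 2 ≤ 4 * |Real.sin (Real.pi * z.re)| ^ 2 := by nlinarith
    calc _ ≤ Real.exp (-2 * Real.pi * |z.im|) * (4 * |Real.sin (Real.pi * z.re)| ^ 2) :=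
          mul_le_mul hr h3 (by positivity) (Real.exp_nonneg _)
      _ ≤ _ := by nlinarith [sq_nonneg (1 - Real.exp (-2 * Real.pi * |z.im|))]
  have h3 : ‖z‖ ≤ |z.re| + |z.im| := Complex.norm_le_abs_re_add_abs_im z
  have h4 : 0 ≤ 1 - |z.re| := by linarith
  have h5 : (1 - |z.re|) * |z.im| ≤ |z.im| := by nlinarith [abs_nonneg z.im, abs_nonneg z.re]
  calc c / 2 * ((1 - |z.re|) * ‖z‖) ≤ c / 2 * ((1 - |z.re|) * (|z.re| + |z.im|)) := by gcongr
    _ = (c * (|z.re| * (1 - |z.re|)) + c * ((1 - |z.re|) * |z.im|)) / 2 := by ring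
    _ ≤ (D + 1 / 2 * |z.im|) / 2 := by gcongr
    _ ≤ D := by linarith

lemma norm_one_sub_le_mul_norm (z : ℂ) :
    ‖1 - unitChar z.re * Real.exp (-2 * Real.pi * |z.im|)‖ ≤ 4 * Real.pi * ‖z‖ := by
  have hpi := Real.pi_pos
  set r := Real.exp (-2 * Real.pi * |z.im|) with hr
  have hr1 : r ≤ 1 := by
    rw [hr, Real.exp_le_one_iff]
    nlinarith [mul_nonneg hpi.le (abs_nonneg z.im)]
  have hr2 : 1 - r ≤ 2 * Real.pi * |z.im| := by
    have := Real.add_one_le_exp (-2 * Real.pi * |z.im|); linarith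
  have h1 : ‖unitChar z.re - 1‖ ≤ 2 * Real.pi * |z.re| := by
    have := Real.norm_exp_I_mul_ofReal_sub_one_le (x := 2 * Real.pi * z.re)
    rw [Real.norm_eq_abs, abs_mul, abs_of_pos (by positivity : 0 < 2 * Real.pi)] at this
    convert this using 3
    rw [unitChar]; push_cast; ring_nf
  have e : 1 - unitChar z.re * (r : ℂ) = ((1 - r : ℝ) : ℂ) - r * (unitChar z.re - 1) := by
    push_cast; ring
  rw [e]
  refine (norm_sub_le _ _).trans ?_
  rw [norm_mul, Complex.norm_real, Complex.norm_real, Real.norm_of_nonneg (by linarith),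
    Real.norm_of_nonneg (Real.exp_nonneg _)]
  have h2 : r * ‖unitChar z.re - 1‖ ≤ 1 * (2 * Real.pi * |z.re|) :=
    mul_le_mul hr1 h1 (norm_nonneg _) zero_le_one
  have h3 := Complex.abs_re_le_norm z
  have h4 := Complex.abs_im_le_norm z
  nlinarith

lemma abs_mul_log_le_one {t : ℝ} (h0 : 0 ≤ t) (h1 : t ≤ 1) : |t * Real.log t| ≤ 1 := by
  rcases h0.eq_or_lt with rfl | h
  · simp
  · rw [mul_comm]; exact (Real.abs_log_mul_self_lt t h h1).le

/-- Subtracting log‖z‖ removes the singularity at 0. Those at ±1 are of size log(1 - |Re z|) and are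
absorbed by the weight, as t log t is bounded on [0,1]. -/
lemma mul_abs_logKernel_sub_log_le {z : ℂ} (hu : |z.re| ≤ 1) (hv : |z.im| ≤ 1) :
    (1 - |z.re|) * |logKernel z.re |z.im| - Real.log ‖z‖| ≤
      1 + |Real.log (Real.exp (-Real.pi) / 2)| + |Real.log (4 * Real.pi)| := by
  have hpos1 : 0 ≤ |Real.log (Real.exp (-Real.pi) / 2)| := abs_nonneg _
  have hpos2 : 0 ≤ |Real.log (4 * Real.pi)| := abs_nonneg _
  rcases hu.eq_or_lt with h | h
  · rw [h]; simp only [sub_self, zero_mul]; positivity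
  by_cases hz : z = 0
  · simp only [hz, logKernel, unitChar]; simp; positivity
  have hz' : 0 < ‖z‖ := norm_pos_iff.mpr hz
  have ht : 0 < 1 - |z.re| := by linarith
  have hlow := mul_norm_le_norm_one_sub hu hv
  have hup := norm_one_sub_le_mul_norm z
  have hc : 0 < Real.exp (-Real.pi) / 2 := by positivity
  have hD : 0 < ‖1 - unitChar z.re * Real.exp (-2 * Real.pi * |z.im|)‖ :=
    lt_of_lt_of_le (by positivity) hlow
  have h1 := Real.log_le_log (by positivity) hlow
  have h2 := Real.log_le_log hD hup
  rw [Real.log_mul hc.ne' (by positivity), Real.log_mul ht.ne' hz'.ne'] at h1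
  rw [Real.log_mul (by positivity) hz'.ne'] at h2
  rw [logKernel]
  set Lw := Real.log ‖1 - unitChar z.re * Real.exp (-2 * Real.pi * |z.im|)‖
  have h3 : Real.log (1 - |z.re|) ≤ 0 :=
    Real.log_nonpos ht.le (by linarith [abs_nonneg z.re])
  have h4 := abs_mul_log_le_one ht.le (by linarith [abs_nonneg z.re])
  rw [abs_le] at h4
  have h5 : |Lw - Real.log ‖z‖| ≤ -Real.log (1 - |z.re|) +
      |Real.log (Real.exp (-Real.pi) / 2)| + |Real.log (4 * Real.pi)| := by
    rw [abs_le]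
    constructor
    · linarith [neg_abs_le (Real.log (Real.exp (-Real.pi) / 2))]
    · linarith [le_abs_self (Real.log (4 * Real.pi))]
  have h6 : 1 - |z.re| ≤ 1 := by linarith [abs_nonneg z.re]
  nlinarith [mul_le_mul_of_nonneg_left h5 ht.le, mul_le_mul_of_nonneg_right h6 hpos1,
    mul_le_mul_of_nonneg_right h6 hpos2]

lemma mul_abs_logKernel_le (u : ℝ) {v : ℝ} (hv : v ∈ Set.Icc (0 : ℝ) 1) :
    v * |logKernel u v| ≤ 1 + 2 * Real.log 2 := by
  have hlog := Real.log_nonneg one_le_two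
  rcases hv.1.eq_or_lt with h | h
  · rw [← h, zero_mul]; positivity
  have h1 := half_le_norm_one_sub u hv
  have h2 := logKernel_le_log_two u hv.1
  have h3 : Real.log (v / 2) ≤ logKernel u v := Real.log_le_log (by positivity) h1
  rw [Real.log_div h.ne' two_ne_zero] at h3
  have h4 := abs_mul_log_le_one hv.1 hv.2
  rw [abs_le] at h4
  have h5 : Real.log v ≤ 0 := Real.log_nonpos hv.1 hv.2
  have h6 : |logKernel u v| ≤ -Real.log v + 2 * Real.log 2 := by
    rw [abs_le]; constructor <;> linarith
  nlinarith [mul_le_mul_of_nonneg_left h6 hv.1, mul_le_mul_of_nonneg_right hv.2 hlog]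

lemma exists_abs_kroneckerTail_le :
    ∃ C : ℝ, 0 ≤ C ∧ ∀ u, ∀ v ∈ Set.Icc (0 : ℝ) 1, |kroneckerTail u v| ≤ C :=
  ⟨_, tsum_nonneg fun m => by positivity, fun u _ hv =>
    tsum_of_norm_bounded summable_two_mul_exp_neg_one_pow.hasSum (norm_kroneckerTailTerm_le u hv)⟩

/-! ### The limit function on the plane and the tent weight -/

/-- The Kronecker limit function on the plane, with the imaginary part clamped to `[0, 1]`. -/
noncomputable def kroneckerPlane (z : ℂ) : ℝ := kronecker z.re (min |z.im| 1)

/-- The constant `2π η(i)²`. -/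
noncomputable def etaConst : ℝ := 2 * Real.pi * ‖ModularForm.eta Complex.I‖ ^ 2

/-- The regular part at the origin of the Kronecker limit function. -/
noncomputable def kroneckerRem (z : ℂ) : ℝ :=
  kroneckerPlane z + 2 * Real.pi * Real.log ‖z‖ + 2 * Real.pi * Real.log etaConst

lemma min_abs_mem_Icc (x : ℝ) : min |x| 1 ∈ Set.Icc (0 : ℝ) 1 :=
  ⟨le_min (abs_nonneg _) zero_le_one, min_le_right _ _⟩

lemma continuous_kroneckerTail :
    Continuous fun z : ℂ => kroneckerTail z.re (min |z.im| 1) := by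
  refine continuous_tsum (fun m => ?_) summable_two_mul_exp_neg_one_pow
    (fun m z => norm_kroneckerTailTerm_le z.re (min_abs_mem_Icc z.im) m)
  unfold kroneckerTailTerm
  have := Complex.continuous_re
  have := Complex.continuous_im
  fun_prop

lemma measurable_kroneckerPlane : Measurable kroneckerPlane := by
  have h1 := continuous_kroneckerTail.measurable
  have hre := Complex.continuous_re
  have him := Complex.continuous_im
  have h2 : Measurable fun z : ℂ => logKernel z.re (min |z.im| 1) := by
    unfold logKernel unitChar
    refine Real.measurable_log.comp (Continuous.measurable ?_)
    fun_prop
  have h3 : Measurable fun z : ℂ => logKernel z.re (1 - min |z.im| 1) := by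
    unfold logKernel unitChar
    refine Real.measurable_log.comp (Continuous.measurable ?_)
    fun_prop
  have h4 : Measurable fun z : ℂ =>
      2 * Real.pi ^ 2 * ((min |z.im| 1) ^ 2 - (min |z.im| 1) + 1 / 6) := by
    refine Continuous.measurable ?_
    fun_prop
  unfold kroneckerPlane kronecker
  exact ((h4.sub (h2.const_mul _)).sub (h3.const_mul _)).add (h1.const_mul _)

/-- All logarithmic singularities of the kernel go to +∞. Adding κ therefore makes the pair sums
nonnegative, so that their expectations can be computed without knowing integrability. -/
lemma exists_neg_le_kroneckerPlane : ∃ κ : ℝ, 0 ≤ κ ∧ ∀ z, -κ ≤ kroneckerPlane z := by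
  obtain ⟨C, hC0, hC⟩ := exists_abs_kroneckerTail_le
  have hpi := Real.pi_pos
  have hlog := Real.log_nonneg one_le_two
  refine ⟨2 * Real.pi ^ 2 + 4 * Real.pi * Real.log 2 + 2 * Real.pi * C, by positivity, fun z => ?_⟩
  have hv := min_abs_mem_Icc z.im
  rw [kroneckerPlane, kronecker]
  set v := min |z.im| 1
  have h1 := logKernel_le_log_two z.re hv.1
  have h2 := logKernel_le_log_two z.re (sub_nonneg.mpr hv.2)
  have h3 := (abs_le.mp (hC z.re v hv)).1
  have h4 : -1 ≤ v ^ 2 - v + 1 / 6 := by nlinarith [hv.1, hv.2]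
  nlinarith [mul_le_mul_of_nonneg_left h1 hpi.le, mul_le_mul_of_nonneg_left h2 hpi.le,
    mul_le_mul_of_nonneg_left h3 hpi.le, mul_le_mul_of_nonneg_left h4 (sq_nonneg Real.pi)]

/-- The weight `(1 - |x|)⁺ (1 - |y|)⁺`. -/
noncomputable def tent (z : ℂ) : ℝ := max 0 (1 - |z.re|) * max 0 (1 - |z.im|)

lemma tent_nonneg (z : ℂ) : 0 ≤ tent z := mul_nonneg (le_max_left _ _) (le_max_left _ _)

lemma tent_le_one (z : ℂ) : tent z ≤ 1 :=
  mul_le_one₀ (max_le zero_le_one (by linarith [abs_nonneg z.re])) (le_max_left _ _)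
    (max_le zero_le_one (by linarith [abs_nonneg z.im]))

lemma continuous_tent : Continuous tent := by
  have hre := Complex.continuous_re
  have him := Complex.continuous_im
  unfold tent
  fun_prop

lemma tent_eq {z : ℂ} (hu : |z.re| ≤ 1) (hv : |z.im| ≤ 1) :
    tent z = (1 - |z.re|) * (1 - |z.im|) := by
  rw [tent, max_eq_right (by linarith), max_eq_right (by linarith)]

lemma tent_eq_zero {z : ℂ} (h : ¬ (|z.re| ≤ 1 ∧ |z.im| ≤ 1)) : tent z = 0 := by
  rw [not_and_or, not_le, not_le] at h
  rcases h with h | h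
  · rw [tent, max_eq_left (by linarith : 1 - |z.re| ≤ 0), zero_mul]
  · rw [tent, max_eq_left (by linarith : 1 - |z.im| ≤ 0), mul_zero]

lemma one_sub_tent_le (z : ℂ) : 1 - tent z ≤ 2 * ‖z‖ := by
  have h1 := Complex.abs_re_le_norm z
  have h2 := Complex.abs_im_le_norm z
  have h3 := abs_nonneg z.re
  have h4 := abs_nonneg z.im
  by_cases h : |z.re| ≤ 1 ∧ |z.im| ≤ 1
  · rw [tent_eq h.1 h.2]; nlinarith
  · rw [tent_eq_zero h]
    rw [not_and_or, not_le, not_le] at h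
    rcases h with h | h <;> linarith

/-- After the singularity at 0 is removed, singularities remain at z = ±1 and at the points with |Im
z| = 1 and integral real part. The two factors of the tent vanish there to first order and tame
them. -/
lemma exists_abs_tent_mul_kroneckerRem_le :
    ∃ C : ℝ, 0 ≤ C ∧ ∀ z, |tent z * kroneckerRem z| ≤ C := by
  obtain ⟨T, hT0, hT⟩ := exists_abs_kroneckerTail_le
  have hpi := Real.pi_pos
  have hlog := Real.log_nonneg one_le_two
  set A := 1 + |Real.log (Real.exp (-Real.pi) / 2)| + |Real.log (4 * Real.pi)| with hA
  set C := 2 * Real.pi ^ 2 + 2 * Real.pi * A + 2 * Real.pi * (1 + 2 * Real.log 2) +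
    2 * Real.pi * T + 2 * Real.pi * |Real.log etaConst| with hC
  have hC0 : 0 ≤ C := by positivity
  refine ⟨C, hC0, fun z => ?_⟩
  by_cases h : |z.re| ≤ 1 ∧ |z.im| ≤ 1
  swap
  · rw [tent_eq_zero h, zero_mul, abs_zero]; exact hC0
  obtain ⟨hu, hv⟩ := h
  have h1 := mul_abs_logKernel_sub_log_le hu hv
  have hv' : 1 - |z.im| ∈ Set.Icc (0 : ℝ) 1 := ⟨by linarith, by linarith [abs_nonneg z.im]⟩
  have hu' : 1 - |z.re| ∈ Set.Icc (0 : ℝ) 1 := ⟨by linarith, by linarith [abs_nonneg z.re]⟩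
  have h2 := mul_abs_logKernel_le z.re hv'
  have h3 := hT z.re |z.im| ⟨abs_nonneg _, hv⟩
  have h4 : |(|z.im| ^ 2 - |z.im| + 1 / 6)| ≤ 1 := by
    rw [abs_le]; constructor <;> nlinarith [abs_nonneg z.im]
  have e : tent z * kroneckerRem z =
      tent z * (2 * Real.pi ^ 2 * (|z.im| ^ 2 - |z.im| + 1 / 6)) -
      2 * Real.pi * ((1 - |z.im|) * ((1 - |z.re|) * (logKernel z.re |z.im| - Real.log ‖z‖))) -
      2 * Real.pi * ((1 - |z.re|) * ((1 - |z.im|) * logKernel z.re (1 - |z.im|))) +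
      tent z * (2 * Real.pi * kroneckerTail z.re |z.im|) +
      tent z * (2 * Real.pi * Real.log etaConst) := by
    rw [tent_eq hu hv, kroneckerRem, kroneckerPlane, min_eq_left hv, kronecker]
    ring
  have ht : |tent z| ≤ 1 := by rw [abs_of_nonneg (tent_nonneg z)]; exact tent_le_one z
  have b1 : |tent z * (2 * Real.pi ^ 2 * (|z.im| ^ 2 - |z.im| + 1 / 6))| ≤ 2 * Real.pi ^ 2 := by
    rw [abs_mul, abs_mul, abs_of_pos (by positivity : 0 < 2 * Real.pi ^ 2)]
    calc _ ≤ 1 * (2 * Real.pi ^ 2 * 1) := by gcongr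
      _ = _ := by ring
  have b2 : |2 * Real.pi * ((1 - |z.im|) * ((1 - |z.re|) * (logKernel z.re |z.im| -
      Real.log ‖z‖)))| ≤ 2 * Real.pi * A := by
    rw [abs_mul, abs_of_pos (by positivity : 0 < 2 * Real.pi), abs_mul, abs_mul,
      abs_of_nonneg hv'.1, abs_of_nonneg hu'.1]
    have : (1 - |z.im|) * ((1 - |z.re|) * |logKernel z.re |z.im| - Real.log ‖z‖|) ≤ 1 * A :=
      mul_le_mul hv'.2 h1 (mul_nonneg hu'.1 (abs_nonneg _)) zero_le_one
    rw [one_mul] at this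
    gcongr
  have b3 : |2 * Real.pi * ((1 - |z.re|) * ((1 - |z.im|) * logKernel z.re (1 - |z.im|)))| ≤
      2 * Real.pi * (1 + 2 * Real.log 2) := by
    rw [abs_mul, abs_of_pos (by positivity : 0 < 2 * Real.pi), abs_mul, abs_mul,
      abs_of_nonneg hv'.1, abs_of_nonneg hu'.1]
    have : (1 - |z.re|) * ((1 - |z.im|) * |logKernel z.re (1 - |z.im|)|) ≤
        1 * (1 + 2 * Real.log 2) :=
      mul_le_mul hu'.2 h2 (mul_nonneg hv'.1 (abs_nonneg _)) zero_le_one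
    rw [one_mul] at this
    gcongr
  have b4 : |tent z * (2 * Real.pi * kroneckerTail z.re |z.im|)| ≤ 2 * Real.pi * T := by
    rw [abs_mul, abs_mul, abs_of_pos (by positivity : 0 < 2 * Real.pi)]
    calc _ ≤ 1 * (2 * Real.pi * T) := by gcongr
      _ = _ := by ring
  have b5 : |tent z * (2 * Real.pi * Real.log etaConst)| ≤ 2 * Real.pi * |Real.log etaConst| := by
    rw [abs_mul, abs_mul, abs_of_pos (by positivity : 0 < 2 * Real.pi)]
    calc _ ≤ 1 * (2 * Real.pi * |Real.log etaConst|) := by gcongr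
      _ = _ := by ring
  rw [e, hC]
  refine (abs_add_le _ _).trans (add_le_add ((abs_add_le _ _).trans (add_le_add
    ((abs_sub _ _).trans (add_le_add ((abs_sub _ _).trans (add_le_add b1 b2)) b3)) b4)) b5)

/-! ### The constant term at the origin and the eta function -/

section EtaConstant

lemma exp_neg_two_pi_lt_one : Real.exp (-2 * Real.pi) < 1 := by
  rw [Real.exp_lt_one_iff]; linarith [Real.pi_pos]

/-- Expand each logarithm as a power series, interchange the absolutely convergent double sum, and
sum the geometric series in k. -/
lemma hasSum_log_one_sub_pow {q : ℝ} (hq0 : 0 ≤ q) (hq1 : q < 1) :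
    HasSum (fun k : ℕ => Real.log (1 - q ^ (k + 1)))
      (-∑' m : ℕ, q ^ (m + 1) / ((m + 1) * (1 - q ^ (m + 1)))) := by
  set f : ℕ → ℕ → ℝ := fun k m => (q ^ (k + 1)) ^ (m + 1) / (m + 1) with hf
  have hg := summable_geometric_of_lt_one hq0 hq1
  have hsum : Summable (Function.uncurry f) := by
    refine Summable.of_nonneg_of_le (fun p => by simp only [Function.uncurry, hf]; positivity)
      (fun p => ?_) (hg.mul_of_nonneg hg (fun n => by positivity) (fun n => by positivity))
    simp only [Function.uncurry, hf]
    have h1 : (1 : ℝ) ≤ (p.2 : ℝ) + 1 := by linarith [(Nat.cast_nonneg p.2 : (0 : ℝ) ≤ p.2)]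
    refine (div_le_self (by positivity) h1).trans ?_
    rw [← pow_mul, ← pow_add]
    exact pow_le_pow_of_le_one hq0 hq1.le (by nlinarith)
  have hk : ∀ k : ℕ, HasSum (f k) (-Real.log (1 - q ^ (k + 1))) := fun k =>
    Real.hasSum_pow_div_log_of_abs_lt_one (by
      rw [abs_of_nonneg (by positivity)]; exact pow_lt_one₀ hq0 hq1 (by omega))
  have h1 : HasSum (fun k : ℕ => -Real.log (1 - q ^ (k + 1)))
      (∑' p, Function.uncurry f p) := hsum.hasSum.prod_fiberwise hk
  have h2 : ∑' p, Function.uncurry f p =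
      ∑' m : ℕ, q ^ (m + 1) / ((m + 1) * (1 - q ^ (m + 1))) := by
    rw [hsum.tsum_prod]
    change ∑' k, ∑' m, f k m = _
    rw [← hsum.tsum_comm]
    refine tsum_congr fun m => ?_
    have hm : q ^ (m + 1) < 1 := pow_lt_one₀ hq0 hq1 (by omega)
    have h3 : ∀ k, f k m = q ^ (m + 1) / (m + 1) * (q ^ (m + 1)) ^ k := fun k => by
      simp only [hf]; ring
    simp_rw [h3]
    rw [tsum_mul_left, tsum_geometric_of_lt_one (by positivity) hm, ← div_eq_mul_inv, div_div]
  rw [h2] at h1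
  simpa using h1.neg

lemma log_norm_eta_I :
    Real.log ‖ModularForm.eta Complex.I‖ = -(Real.pi / 12) -
      ∑' m : ℕ, Real.exp (-2 * Real.pi) ^ (m + 1) /
        ((m + 1) * (1 - Real.exp (-2 * Real.pi) ^ (m + 1))) := by
  set q := Real.exp (-2 * Real.pi) with hq
  have hq0 : 0 ≤ q := Real.exp_nonneg _
  have hlt : ∀ m : ℕ, q ^ (m + 1) < 1 := fun m =>
    pow_lt_one₀ hq0 exp_neg_two_pi_lt_one (by omega)
  have h1 := (hasSum_log_one_sub_pow hq0 exp_neg_two_pi_lt_one).rexp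
  have h2 : HasProd (fun k : ℕ => 1 - q ^ (k + 1))
      (Real.exp (-∑' m : ℕ, q ^ (m + 1) / ((m + 1) * (1 - q ^ (m + 1))))) := by
    convert! h1 using 1
    ext k
    exact (Real.exp_log (by linarith [hlt k])).symm
  have h3 := h2.map Complex.ofRealHom Complex.continuous_ofReal
  have h4 : ∏' n, (1 - ModularForm.eta_q n Complex.I) =
      ((Real.exp (-∑' m : ℕ, q ^ (m + 1) / ((m + 1) * (1 - q ^ (m + 1)))) : ℝ) : ℂ) := by
    rw [← Complex.ofRealHom_eq_coe, ← h3.tprod_eq]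
    refine tprod_congr fun n => ?_
    simp only [Function.comp_apply, map_sub, map_one, map_pow]
    rw [ModularForm.eta_q_eq_pow, Complex.ofRealHom_eq_coe, hq, Complex.ofReal_exp]
    congr 3
    push_cast
    rw [mul_assoc, Complex.I_mul_I]
    ring
  have h5 : ‖Function.Periodic.qParam 24 Complex.I‖ = Real.exp (-(Real.pi / 12)) := by
    rw [Function.Periodic.norm_qParam]
    simp only [Complex.I_im]
    congr 1
    ring
  rw [ModularForm.eta, norm_mul, h5, h4, Complex.norm_real,
    Real.norm_of_nonneg (Real.exp_nonneg _), ← Real.exp_add, Real.log_exp]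
  ring

lemma norm_eta_I_pos : 0 < ‖ModularForm.eta Complex.I‖ := by
  rw [norm_pos_iff]
  exact ModularForm.eta_ne_zero (by simp)

lemma etaConst_pos : 0 < etaConst := by
  have := norm_eta_I_pos
  have := Real.pi_pos
  unfold etaConst
  positivity

/-- Termwise, with p = q^(m+1), this is p(1 + p)/(1 - p) + p = 2p/(1 - p), divided by m + 1. The
right side is thus minus twice the logarithm of the Euler product in η(i). -/
lemma kroneckerTail_zero_sub_log :
    kroneckerTail 0 0 - Real.log (1 - Real.exp (-2 * Real.pi)) =
      2 * ∑' m : ℕ, Real.exp (-2 * Real.pi) ^ (m + 1) /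
        ((m + 1) * (1 - Real.exp (-2 * Real.pi) ^ (m + 1))) := by
  set q := Real.exp (-2 * Real.pi) with hq
  have hq0 : 0 < q := Real.exp_pos _
  have h1 := hasSum_kroneckerTail 0 (v := 0) ⟨le_rfl, zero_le_one⟩
  have h2 := Real.hasSum_pow_div_log_of_abs_lt_one (x := q)
    (by rw [abs_of_nonneg hq0.le]; exact exp_neg_two_pi_lt_one)
  have h3 := h1.add h2
  rw [sub_eq_add_neg, ← h3.tsum_eq, ← tsum_mul_left]
  refine tsum_congr fun m => ?_
  have hlt : q ^ (m + 1) < 1 := pow_lt_one₀ hq0.le exp_neg_two_pi_lt_one (by omega)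
  have hQ : Real.exp (2 * Real.pi * (m + 1)) = (q ^ (m + 1))⁻¹ := by
    rw [hq, ← Real.exp_nat_mul, ← Real.exp_neg]; push_cast; ring_nf
  have hQ' : Real.exp (-2 * Real.pi * (m + 1) * (1 - 0)) = q ^ (m + 1) := by
    rw [hq, ← Real.exp_nat_mul]; push_cast; ring_nf
  rw [kroneckerTailTerm, hQ, hQ']
  simp only [mul_zero, Real.cos_zero, Real.exp_zero, one_mul]
  have hp : q ^ (m + 1) ≠ 0 := (pow_pos hq0 _).ne'
  set p := q ^ (m + 1)
  have h4 : 1 - p ≠ 0 := by linarith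
  have h5 : p⁻¹ - 1 ≠ 0 := by
    rw [show p⁻¹ - 1 = (1 - p) / p by field_simp]; positivity
  rw [show p⁻¹ - 1 = (1 - p) / p by field_simp]
  field_simp
  ring

end EtaConstant

/-- After reflecting z into the upper half plane, which preserves ‖z‖, the difference is the
logarithm of a difference quotient of e^{2πiz} at 0. -/
lemma tendsto_logKernel_sub_log :
    Tendsto (fun z : ℂ => logKernel z.re |z.im| - Real.log ‖z‖) (𝓝[≠] 0)
      (𝓝 (Real.log (2 * Real.pi))) := by
  set fold : ℂ → ℂ := fun z => ⟨z.re, |z.im|⟩ with hfold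
  have hnorm : ∀ z, ‖fold z‖ = ‖z‖ := fun z => by
    rw [Complex.norm_def, Complex.norm_def, Complex.normSq_apply, Complex.normSq_apply]
    simp [hfold]
  have hder : HasDerivAt (fun z : ℂ => Complex.exp (2 * Real.pi * Complex.I * z))
      (2 * Real.pi * Complex.I) 0 := by
    have h := ((hasDerivAt_id (0 : ℂ)).const_mul (2 * Real.pi * Complex.I)).cexp
    simpa using h
  have hslope := hder.tendsto_slope.norm
  have hfold0 : Tendsto fold (𝓝[≠] 0) (𝓝[≠] 0) := by
    refine tendsto_nhdsWithin_iff.mpr ⟨?_, ?_⟩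
    · rw [tendsto_zero_iff_norm_tendsto_zero]
      simp_rw [hnorm]
      exact (continuous_norm.tendsto' (0 : ℂ) 0 norm_zero).mono_left nhdsWithin_le_nhds
    · filter_upwards [self_mem_nhdsWithin] with z hz h
      apply hz
      have h' : fold z = 0 := h
      have : ‖fold z‖ = 0 := by rw [h', norm_zero]
      rw [hnorm] at this
      exact norm_eq_zero.mp this
  have h1 : ‖(2 * Real.pi * Complex.I : ℂ)‖ = 2 * Real.pi := by
    simp [abs_of_pos Real.pi_pos]
  rw [h1] at hslope
  have h2 := ((Real.continuousAt_log (by positivity : 2 * Real.pi ≠ 0)).tendsto).comp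
    (hslope.comp hfold0)
  refine h2.congr' ?_
  have hsmall : ∀ᶠ z : ℂ in 𝓝[≠] 0, ‖slope (fun z : ℂ =>
      Complex.exp (2 * Real.pi * Complex.I * z)) 0 (fold z)‖ ≠ 0 :=
    (hslope.comp hfold0).eventually_ne (by positivity)
  filter_upwards [self_mem_nhdsWithin, hsmall] with z hz hs
  have hz' : ‖z‖ ≠ 0 := norm_ne_zero_iff.mpr hz
  have e : ‖slope (fun z : ℂ => Complex.exp (2 * Real.pi * Complex.I * z)) 0 (fold z)‖ =
      ‖1 - unitChar z.re * Real.exp (-2 * Real.pi * |z.im|)‖ / ‖z‖ := by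
    rw [slope_def_field, norm_div, sub_zero, hnorm, mul_zero, Complex.exp_zero, norm_sub_rev]
    congr 3
    rw [unitChar, Complex.ofReal_exp, ← Complex.exp_add]
    congr 1
    rw [show fold z = z.re + |z.im| * Complex.I from (Complex.re_add_im (fold z)).symm]
    push_cast
    ring_nf
    rw [Complex.I_sq]
    ring
  simp only [Function.comp_apply]
  rw [e] at hs ⊢
  rw [Real.log_div (fun h => hs (by rw [h, zero_div])) hz', logKernel]

lemma tendsto_kroneckerRem : Tendsto kroneckerRem (𝓝[≠] 0) (𝓝 0) := by
  have hre := Complex.continuous_re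
  have him := Complex.continuous_im
  have hq := exp_neg_two_pi_lt_one
  have h1 : Tendsto (fun z : ℂ =>
      2 * Real.pi ^ 2 * ((min |z.im| 1) ^ 2 - (min |z.im| 1) + 1 / 6)) (𝓝[≠] 0)
      (𝓝 (Real.pi ^ 2 / 3)) :=
    (Continuous.tendsto' (by fun_prop) _ _ (by simp; ring)).mono_left nhdsWithin_le_nhds
  have h2 := tendsto_logKernel_sub_log.const_mul (2 * Real.pi)
  have h3 : Tendsto (fun z : ℂ => logKernel z.re (1 - min |z.im| 1)) (𝓝[≠] 0)
      (𝓝 (Real.log (1 - Real.exp (-2 * Real.pi)))) := by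
    unfold logKernel
    have h := ((Real.continuousAt_log (by linarith : 1 - Real.exp (-2 * Real.pi) ≠ 0)).tendsto)
    refine h.comp (Tendsto.mono_left ?_ nhdsWithin_le_nhds)
    refine Continuous.tendsto' (by unfold unitChar; fun_prop) _ _ ?_
    simp only [Complex.zero_re, Complex.zero_im, unitChar]
    simp only [Complex.ofReal_zero, mul_zero, Complex.exp_zero, one_mul, abs_zero]
    rw [min_eq_left zero_le_one, sub_zero, mul_one, ← Complex.ofReal_one, ← Complex.ofReal_sub,
      Complex.norm_real, Real.norm_of_nonneg (by linarith)]
  have h4 : Tendsto (fun z : ℂ => kroneckerTail z.re (min |z.im| 1)) (𝓝[≠] 0)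
      (𝓝 (kroneckerTail 0 0)) :=
    (continuous_kroneckerTail.tendsto' _ _ (by simp)).mono_left nhdsWithin_le_nhds
  have h5 := (((h1.sub h2).sub (h3.const_mul (2 * Real.pi))).add
    (h4.const_mul (2 * Real.pi))).add_const (2 * Real.pi * Real.log etaConst)
  -- The constants cancel exactly: π²/3 matches the factor q^{1/24} of η(i), and the other terms
  -- match its Euler product and the factor 2π.
  have e : Real.pi ^ 2 / 3 - 2 * Real.pi * Real.log (2 * Real.pi) -
      2 * Real.pi * Real.log (1 - Real.exp (-2 * Real.pi)) + 2 * Real.pi * kroneckerTail 0 0 +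
        2 * Real.pi * Real.log etaConst = 0 := by
    have hk := kroneckerTail_zero_sub_log
    have hl := log_norm_eta_I
    have hc : Real.log etaConst =
        Real.log (2 * Real.pi) + 2 * Real.log ‖ModularForm.eta Complex.I‖ := by
      rw [etaConst, Real.log_mul (by positivity) (pow_ne_zero _ norm_eta_I_pos.ne'), Real.log_pow]
      push_cast; rfl
    rw [hc]
    linear_combination (2 * Real.pi) * hk + (4 * Real.pi) * hl
  rw [e] at h5
  refine h5.congr' ?_
  have hball : ∀ᶠ z : ℂ in 𝓝[≠] 0, ‖z‖ < 1 :=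
    nhdsWithin_le_nhds ((continuous_norm.tendsto' (0 : ℂ) 0 norm_zero).eventually_lt_const one_pos)
  filter_upwards [hball] with z hz
  have him : |z.im| ≤ 1 := (Complex.abs_im_le_norm z).trans hz.le
  rw [kroneckerRem, kroneckerPlane, kronecker, min_eq_left him]
  ring

/-! ### The weighted mean of the limit function vanishes -/

section MeanZero

lemma integral_one_sub_mul_cos (m : ℕ) :
    ∫ u in (0 : ℝ)..1, (1 - u) * Real.cos (2 * Real.pi * ((m + 1) * u)) = 0 := by
  set k : ℝ := 2 * Real.pi * (m + 1) with hk
  have hk0 : k ≠ 0 := by positivity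
  have hd : ∀ u ∈ Set.uIcc (0 : ℝ) 1, HasDerivAt
      (fun u => (1 - u) * (Real.sin (k * u) / k) - Real.cos (k * u) / k ^ 2)
      ((1 - u) * Real.cos (2 * Real.pi * ((m + 1) * u))) u := by
    intro u _
    have h0 : HasDerivAt (fun u : ℝ => k * u) k u := by simpa using (hasDerivAt_id u).const_mul k
    have h1 := ((hasDerivAt_id u).const_sub 1).mul (h0.sin.div_const k)
    have h2 := h0.cos.div_const (k ^ 2)
    convert! h1.sub h2 using 1
    rw [show 2 * Real.pi * ((m + 1) * u) = k * u by rw [hk]; ring]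
    simp only [id]
    field_simp
    ring
  rw [intervalIntegral.integral_eq_sub_of_hasDerivAt hd
    (Continuous.intervalIntegrable (by fun_prop) _ _)]
  have hc : Real.cos (k * 1) = 1 := by
    rw [hk, mul_one, show 2 * Real.pi * ((m : ℝ) + 1) = ((m + 1 : ℕ) : ℝ) * (2 * Real.pi) by
      push_cast; ring]
    exact Real.cos_nat_mul_two_pi _
  rw [hc]
  simp

lemma expKernel_nonneg {a : ℝ} (ha : 0 < a) (v : ℝ) : 0 ≤ expKernel a v := by
  have : Real.exp (-2 * Real.pi * a) < 1 := by
    rw [Real.exp_lt_one_iff]; nlinarith [mul_pos Real.pi_pos ha]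
  have := Real.pi_pos
  exact mul_nonneg (by positivity) (div_nonneg (by positivity) (by linarith))

/-- Termwise integration is allowed because v > 0 makes the cosine series uniformly summable. Every
nonconstant cosine integrates to 0 against 1 - u, leaving half the constant term. -/
lemma integral_one_sub_mul_kronecker {v : ℝ} (hv : v ∈ Set.Ioo (0 : ℝ) 1) :
    ∫ u in (0 : ℝ)..1, (1 - u) * kronecker u v = Real.pi ^ 2 * (v ^ 2 - v + 1 / 6) := by
  set c := 2 * Real.pi ^ 2 * (v ^ 2 - v + 1 / 6) with hc
  set F : ℕ → ℝ → ℝ := fun m u =>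
    (1 - u) * (2 * Real.cos (2 * Real.pi * ((m + 1) * u)) * expKernel (m + 1) v) with hF
  have hsum : ∀ u, HasSum (fun m => F m u) ((1 - u) * (kronecker u v - c)) := fun u =>
    (hasSum_cos_mul_expKernel u hv).mul_left (1 - u)
  have hbound : Summable fun m : ℕ => 2 * expKernel (m + 1) v := by
    simpa using (hasSum_cos_mul_expKernel 0 hv).summable
  have h1 : HasSum (fun m => ∫ u in (0 : ℝ)..1, F m u)
      (∫ u in (0 : ℝ)..1, (1 - u) * (kronecker u v - c)) := by
    refine intervalIntegral.hasSum_integral_of_dominated_convergence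
      (fun m _ => 2 * expKernel (m + 1) v) (fun m => ?_) (fun m => ?_) ?_ ?_ ?_
    · exact (by fun_prop : Continuous (F m)).aestronglyMeasurable
    · refine Eventually.of_forall fun u hu => ?_
      rw [Set.uIoc_of_le zero_le_one] at hu
      have h0 := expKernel_nonneg (a := (m : ℝ) + 1) (by positivity) v
      simp only [hF, norm_mul, Real.norm_of_nonneg h0, Real.norm_eq_abs]
      have a1 : |1 - u| ≤ 1 := by rw [abs_le]; constructor <;> linarith [hu.1, hu.2]
      have a2 := Real.abs_cos_le_one (2 * Real.pi * ((m + 1) * u))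
      rw [abs_of_pos (two_pos : (0 : ℝ) < 2)]
      calc _ ≤ 1 * (2 * 1 * expKernel (m + 1) v) := by gcongr
        _ = _ := by ring
    · exact Eventually.of_forall fun u _ => hbound
    · exact intervalIntegrable_const
    · exact Eventually.of_forall fun u _ => hsum u
  have h2 : ∀ m, ∫ u in (0 : ℝ)..1, F m u = 0 := by
    intro m
    have : F m = fun u => (2 * expKernel (m + 1) v) *
        ((1 - u) * Real.cos (2 * Real.pi * ((m + 1) * u))) := by
      ext u; simp only [hF]; ring
    rw [this, intervalIntegral.integral_const_mul, integral_one_sub_mul_cos, mul_zero]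
  simp_rw [h2] at h1
  have h3 := h1.unique hasSum_zero
  have hcont : Continuous fun u => (1 - u) * (kronecker u v - c) := by
    have e : (fun u => (1 - u) * (kronecker u v - c)) = fun u => ∑' m : ℕ, (1 - u) *
        (2 * Real.cos (2 * Real.pi * ((m + 1) * u)) * expKernel (m + 1) v) := by
      ext u; exact (hsum u).tsum_eq.symm
    rw [e]
    simp_rw [tsum_mul_left]
    refine (continuous_const.sub continuous_id).mul
      (continuous_tsum (fun m => by fun_prop) hbound fun m u => ?_)
    have h0 := expKernel_nonneg (a := (m : ℝ) + 1) (by positivity) v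
    rw [norm_mul, norm_mul, Real.norm_of_nonneg h0, Real.norm_eq_abs, Real.norm_eq_abs,
      abs_of_pos two_pos]
    have a2 := Real.abs_cos_le_one (2 * Real.pi * ((m + 1) * u))
    calc _ ≤ 2 * 1 * expKernel (m + 1) v := by gcongr
      _ = _ := by ring
  have h4 : ∀ u, (1 - u) * kronecker u v = (1 - u) * (kronecker u v - c) + (1 - u) * c :=
    fun u => by ring
  simp_rw [h4]
  rw [intervalIntegral.integral_add (hcont.intervalIntegrable _ _)
    (Continuous.intervalIntegrable (by fun_prop) _ _), h3, intervalIntegral.integral_mul_const,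
    intervalIntegral.integral_sub (by simp) (by simp), integral_id, hc]
  simp
  ring

lemma integral_max_zero_mul_comp_abs (f : ℝ → ℝ) :
    ∫ x, max 0 (1 - |x|) * f |x| = 2 * ∫ x in (0 : ℝ)..1, (1 - x) * f x := by
  rw [integral_comp_abs (f := fun x => max 0 (1 - x) * f x), intervalIntegral.integral_of_le
    zero_le_one]
  congr 1
  rw [setIntegral_eq_of_subset_of_forall_sdiff_eq_zero measurableSet_Ioi
    (Set.Ioc_subset_Ioi_self : Set.Ioc (0 : ℝ) 1 ⊆ Set.Ioi 0)]
  · refine setIntegral_congr_fun measurableSet_Ioc fun x hx => ?_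
    rw [max_eq_right (by linarith [hx.2])]
  · intro x hx
    have : 1 < x := by
      by_contra h
      exact hx.2 ⟨hx.1, not_lt.mp h⟩
    rw [max_eq_left (by linarith), zero_mul]

lemma integral_tent_mul_kronecker_re {v : ℝ} (hv : v ≠ 0) :
    ∫ u : ℝ, tent ⟨u, v⟩ * kroneckerPlane ⟨u, v⟩ =
      max 0 (1 - |v|) * (2 * Real.pi ^ 2 * (|v| ^ 2 - |v| + 1 / 6)) := by
  rcases lt_or_ge |v| 1 with h | h
  · have hv' : |v| ∈ Set.Ioo (0 : ℝ) 1 := ⟨abs_pos.mpr hv, h⟩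
    have e : ∀ u : ℝ, tent ⟨u, v⟩ * kroneckerPlane ⟨u, v⟩ =
        max 0 (1 - |v|) * (max 0 (1 - |u|) * kronecker |u| |v|) := by
      intro u
      have : kronecker |u| |v| = kronecker u |v| := by
        rcases abs_choice u with h | h <;> rw [h]
        exact kronecker_neg _ _
      rw [this, tent, kroneckerPlane, min_eq_left h.le]
      ring
    simp_rw [e]
    rw [integral_const_mul, integral_max_zero_mul_comp_abs (fun u => kronecker u |v|),
      integral_one_sub_mul_kronecker hv']
    ring
  · have e : ∀ u : ℝ, tent ⟨u, v⟩ * kroneckerPlane ⟨u, v⟩ = 0 := by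
      intro u
      rw [tent, max_eq_left (by simpa using h : 1 - |v| ≤ 0), mul_zero, zero_mul]
    simp_rw [e]
    rw [integral_zero, max_eq_left (by linarith), zero_mul]

/-- A product of functions of one coordinate, so that integrability on the square reduces to that of
log on [-1,1]. -/
lemma abs_log_norm_le {z : ℂ} (hu : |z.re| ≤ 1) (hv : |z.im| ≤ 1) :
    |Real.log ‖z‖| ≤ (|Real.log (z.re)| + 1) * (|Real.log (z.im)| + 1) := by
  have a := abs_nonneg (Real.log z.re)
  have b := abs_nonneg (Real.log z.im)
  have hn : ‖z‖ ≤ 2 := (Complex.norm_le_abs_re_add_abs_im z).trans (by linarith)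
  suffices |Real.log ‖z‖| ≤ |Real.log z.re| + |Real.log z.im| + 1 by nlinarith [mul_nonneg a b]
  by_cases hz : z = 0
  · simp [hz]
  have hz' : 0 < ‖z‖ := norm_pos_iff.mpr hz
  have hup : Real.log ‖z‖ ≤ 1 := (Real.log_le_sub_one_of_pos hz').trans (by linarith)
  have hlow : -Real.log ‖z‖ ≤ |Real.log z.re| + |Real.log z.im| := by
    by_cases hre : z.re = 0
    · have : ‖z‖ = |z.im| := by
        rw [← Complex.re_add_im z, hre]
        simp
      rw [this, Real.log_abs]
      linarith [neg_le_abs (Real.log z.im)]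
    · have := Real.log_le_log (abs_pos.mpr hre) (Complex.abs_re_le_norm z)
      rw [Real.log_abs] at this
      linarith [neg_le_abs (Real.log z.re)]
  rw [abs_le]; constructor <;> linarith

lemma integrable_indicator_abs_log :
    Integrable (Set.indicator (Set.Icc (-1 : ℝ) 1) fun x => |Real.log x| + 1) := by
  rw [integrable_indicator_iff measurableSet_Icc]
  have h : IntegrableOn Real.log (Set.Icc (-1 : ℝ) 1) :=
    (intervalIntegrable_iff_integrableOn_Icc_of_le (by norm_num)).mp
      intervalIntegral.intervalIntegrable_log'
  exact h.abs.add (integrableOn_const (by simp))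

lemma integrable_tent_mul_log : Integrable fun z : ℂ => tent z * Real.log ‖z‖ := by
  have h := (integrable_indicator_abs_log.mul_prod integrable_indicator_abs_log)
  rw [← Measure.volume_eq_prod, ← Complex.volume_preserving_equiv_real_prod.integrable_comp_emb
    Complex.measurableEquivRealProd.measurableEmbedding] at h
  refine h.mono' ?_ (Eventually.of_forall fun z => ?_)
  · exact (continuous_tent.measurable.mul
      (Real.measurable_log.comp measurable_norm)).aestronglyMeasurable
  · simp only [Function.comp_apply, Complex.measurableEquivRealProd_apply]
    by_cases hz : |z.re| ≤ 1 ∧ |z.im| ≤ 1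
    · rw [Set.indicator_of_mem (Set.mem_Icc.mpr (abs_le.mp hz.1)),
        Set.indicator_of_mem (Set.mem_Icc.mpr (abs_le.mp hz.2)), norm_mul,
        Real.norm_of_nonneg (tent_nonneg z)]
      refine le_trans ?_ (abs_log_norm_le hz.1 hz.2)
      exact mul_le_of_le_one_left (norm_nonneg _) (tent_le_one z)
    · rw [tent_eq_zero hz, zero_mul, norm_zero]
      refine mul_nonneg ?_ ?_ <;> refine Set.indicator_nonneg (fun x _ => by positivity) _

lemma integrable_tent : Integrable tent := by
  refine continuous_tent.integrable_of_hasCompactSupport ?_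
  refine HasCompactSupport.of_support_subset_isCompact
    (isCompact_Icc.reProdIm isCompact_Icc : IsCompact (Set.Icc (-1 : ℝ) 1 ×ℂ Set.Icc (-1 : ℝ) 1)) ?_
  intro z hz
  by_contra h
  refine hz (tent_eq_zero fun h' => h ?_)
  exact ⟨abs_le.mp h'.1, abs_le.mp h'.2⟩

lemma measurable_kroneckerRem : Measurable kroneckerRem :=
  (measurable_kroneckerPlane.add ((Real.measurable_log.comp measurable_norm).const_mul _)).add
    measurable_const

lemma integrable_tent_mul_kroneckerPlane : Integrable fun z => tent z * kroneckerPlane z := by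
  obtain ⟨C, hC0, hC⟩ := exists_abs_tent_mul_kroneckerRem_le
  have h1 : Integrable fun z => tent z * kroneckerRem z := by
    set s : Set ℂ := Set.Icc (-1 : ℝ) 1 ×ℂ Set.Icc (-1 : ℝ) 1 with hs
    have hcs : IsCompact s := isCompact_Icc.reProdIm isCompact_Icc
    have h2 : Integrable (s.indicator fun _ => C) :=
      (integrable_indicator_iff hcs.measurableSet).mpr
        (integrableOn_const hcs.measure_lt_top.ne)
    refine h2.mono' (continuous_tent.measurable.mul
      measurable_kroneckerRem).aestronglyMeasurable (Eventually.of_forall fun z => ?_)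
    by_cases hz : z ∈ s
    · rw [Set.indicator_of_mem hz]; exact hC z
    · rw [Set.indicator_of_notMem hz, tent_eq_zero fun h' => hz
        ⟨abs_le.mp h'.1, abs_le.mp h'.2⟩, zero_mul, norm_zero]
  have h3 := (h1.sub (integrable_tent_mul_log.const_mul (2 * Real.pi))).sub
    (integrable_tent.mul_const (2 * Real.pi * Real.log etaConst))
  refine h3.congr (Eventually.of_forall fun z => ?_)
  simp only [Pi.sub_apply, kroneckerRem]
  ring

lemma integral_tent_mul_kroneckerPlane : ∫ z, tent z * kroneckerPlane z = 0 := by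
  have h := integrable_tent_mul_kroneckerPlane
  have hmp := Complex.volume_preserving_equiv_real_prod.symm
  have h' : Integrable (fun p : ℝ × ℝ => tent ⟨p.1, p.2⟩ * kroneckerPlane ⟨p.1, p.2⟩)
      ((volume : Measure ℝ).prod volume) :=
    (hmp.integrable_comp_emb Complex.measurableEquivRealProd.symm.measurableEmbedding).mpr h
  have e1 : ∫ z, tent z * kroneckerPlane z =
      ∫ p : ℝ × ℝ, tent ⟨p.1, p.2⟩ * kroneckerPlane ⟨p.1, p.2⟩ :=
    (hmp.integral_comp' (g := fun z => tent z * kroneckerPlane z)).symm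
  rw [e1, Measure.volume_eq_prod, integral_prod_symm _ h']
  have e2 : ∀ᵐ v : ℝ, ∫ u : ℝ, tent ⟨u, v⟩ * kroneckerPlane ⟨u, v⟩ =
      max 0 (1 - |v|) * (2 * Real.pi ^ 2 * (|v| ^ 2 - |v| + 1 / 6)) := by
    filter_upwards [Measure.ae_ne volume (0 : ℝ)] with v hv
    exact integral_tent_mul_kronecker_re hv
  rw [integral_congr_ae e2,
    integral_max_zero_mul_comp_abs (fun v => 2 * Real.pi ^ 2 * (v ^ 2 - v + 1 / 6))]
  -- What is left is the integral of (1 - x)B₂(x) over [0,1]; this antiderivative takes the value 0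
  -- at both ends.
  have hd : ∀ x ∈ Set.uIcc (0 : ℝ) 1, HasDerivAt
      (fun x : ℝ => 2 * Real.pi ^ 2 * (2 * x ^ 3 / 3 - 7 * x ^ 2 / 12 + x / 6 - x ^ 4 / 4))
      ((1 - x) * (2 * Real.pi ^ 2 * (x ^ 2 - x + 1 / 6))) x := by
    intro x _
    have h1 := ((((((hasDerivAt_pow 3 x).const_mul 2).div_const 3).sub
      (((hasDerivAt_pow 2 x).const_mul 7).div_const 12)).add
        ((hasDerivAt_id x).div_const 6)).sub ((hasDerivAt_pow 4 x).div_const 4)).const_mul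
          (2 * Real.pi ^ 2)
    convert! h1 using 1
    push_cast
    ring
  rw [intervalIntegral.integral_eq_sub_of_hasDerivAt hd
    (Continuous.intervalIntegrable (by fun_prop) _ _)]
  norm_num

end MeanZero

/-! ### Differences of two points of a square -/

lemma volume_reProdIm {s t : Set ℝ} (hs : MeasurableSet s) (ht : MeasurableSet t) :
    volume (s ×ℂ t) = volume s * volume t := by
  have h := Complex.volume_preserving_equiv_real_prod.measure_preimage (hs.prod ht).nullMeasurableSet
  rw [Measure.volume_eq_prod, Measure.prod_prod] at h
  exact h

/-- The square `[0, N]²`. -/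
def square (N : ℕ) : Set ℂ := Set.Icc 0 (N : ℝ) ×ℂ Set.Icc 0 (N : ℝ)

lemma isCompact_square (N : ℕ) : IsCompact (square N) := isCompact_Icc.reProdIm isCompact_Icc

lemma measurableSet_square (N : ℕ) : MeasurableSet (square N) := (isCompact_square N).measurableSet

lemma volume_square (N : ℕ) : volume (square N) = ENNReal.ofReal ((N : ℝ) ^ 2) := by
  rw [square, volume_reProdIm measurableSet_Icc measurableSet_Icc, Real.volume_Icc, sub_zero,
    ← ENNReal.ofReal_mul (Nat.cast_nonneg N), sq]

lemma volume_Icc_inter_sub (N : ℕ) (a : ℝ) :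
    volume (Set.Icc (max 0 (-a)) (min (N : ℝ) (N - a))) = ENNReal.ofReal (N - |a|) := by
  rw [Real.volume_Icc]
  congr 1
  rcases le_total 0 a with h | h
  · rw [max_eq_left (by linarith), min_eq_right (by linarith), abs_of_nonneg h]; ring
  · rw [max_eq_right (by linarith), min_eq_left (by linarith), abs_of_nonpos h]

lemma sq_mul_tent_div {N : ℕ} (hN : 0 < N) (v : ℂ) :
    ENNReal.ofReal (N - |v.re|) * ENNReal.ofReal (N - |v.im|) =
      ENNReal.ofReal ((N : ℝ) ^ 2) * ENNReal.ofReal (tent (v / N)) := by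
  have hN' : (0 : ℝ) < N := Nat.cast_pos.mpr hN
  have key : ∀ a : ℝ, ENNReal.ofReal (N - |a|) =
      ENNReal.ofReal (N * max 0 (1 - |a / N|)) := by
    intro a
    rw [mul_max_of_nonneg _ _ hN'.le, mul_zero, abs_div, abs_of_pos hN', mul_sub, mul_one,
      mul_div_cancel₀ _ hN'.ne', ENNReal.ofReal_max, ENNReal.ofReal_zero, max_eq_right zero_le]
  rw [key, key, ← ENNReal.ofReal_mul (by positivity), ← ENNReal.ofReal_mul (by positivity), tent,
    Complex.div_natCast_re, Complex.div_natCast_im]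
  congr 1
  ring

/-- Substitute v = x - y and use Tonelli: for fixed v the admissible y form the intersection of two
translated squares, of area (N - |Re v|)⁺(N - |Im v|)⁺. -/
lemma lintegral_square_square_sub {N : ℕ} (hN : 0 < N) {g : ℂ → ℝ≥0∞} (hg : Measurable g) :
    ∫⁻ x, ∫⁻ y, (square N).indicator 1 x * (square N).indicator 1 y * g (x - y) =
      ENNReal.ofReal ((N : ℝ) ^ 2) * ∫⁻ v, g v * ENNReal.ofReal (tent (v / N)) := by
  have hm : Measurable ((square N).indicator (1 : ℂ → ℝ≥0∞)) :=
    measurable_one.indicator (measurableSet_square N)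
  rw [lintegral_lintegral_swap (by
    refine Measurable.aemeasurable ?_
    change Measurable fun p : ℂ × ℂ => (square N).indicator 1 p.1 * (square N).indicator 1 p.2 *
      g (p.1 - p.2)
    exact ((hm.comp measurable_fst).mul (hm.comp measurable_snd)).mul
      (hg.comp (measurable_fst.sub measurable_snd)))]
  have e1 : ∀ y : ℂ, ∫⁻ x, (square N).indicator 1 x * (square N).indicator 1 y * g (x - y) =
      ∫⁻ v, (square N).indicator 1 (v + y) * (square N).indicator 1 y * g v := by
    intro y
    rw [← lintegral_add_right_eq_self _ y]
    simp only [add_sub_cancel_right]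
  simp_rw [e1]
  rw [lintegral_lintegral_swap (by
    refine Measurable.aemeasurable ?_
    change Measurable fun p : ℂ × ℂ => (square N).indicator 1 (p.2 + p.1) *
      (square N).indicator 1 p.1 * g p.2
    exact ((hm.comp (measurable_snd.add measurable_fst)).mul (hm.comp measurable_fst)).mul
      (hg.comp measurable_snd)), ← lintegral_const_mul']
  swap
  · exact ENNReal.ofReal_ne_top
  refine lintegral_congr fun v => ?_
  have e2 : ∀ y : ℂ, (square N).indicator (1 : ℂ → ℝ≥0∞) (v + y) * (square N).indicator 1 y * g v =
      (Set.Icc (max 0 (-v.re)) (min (N : ℝ) (N - v.re)) ×ℂ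
        Set.Icc (max 0 (-v.im)) (min (N : ℝ) (N - v.im))).indicator (fun _ => g v) y := by
    intro y
    have hiff : y ∈ Set.Icc (max 0 (-v.re)) (min (N : ℝ) (N - v.re)) ×ℂ
        Set.Icc (max 0 (-v.im)) (min (N : ℝ) (N - v.im)) ↔ v + y ∈ square N ∧ y ∈ square N := by
      simp only [square, Complex.mem_reProdIm, Set.mem_Icc, Complex.add_re, Complex.add_im,
        max_le_iff, le_min_iff]
      constructor
      · rintro ⟨⟨⟨_, _⟩, _, _⟩, ⟨_, _⟩, _, _⟩
        refine ⟨⟨⟨?_, ?_⟩, ?_, ?_⟩, ⟨?_, ?_⟩, ?_, ?_⟩ <;> linarith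
      · rintro ⟨⟨⟨_, _⟩, _, _⟩, ⟨_, _⟩, _, _⟩
        refine ⟨⟨⟨?_, ?_⟩, ?_, ?_⟩, ⟨?_, ?_⟩, ?_, ?_⟩ <;> linarith
    by_cases hy : v + y ∈ square N ∧ y ∈ square N
    · rw [Set.indicator_of_mem (hiff.mpr hy), Set.indicator_of_mem hy.1,
        Set.indicator_of_mem hy.2]
      simp
    · rw [Set.indicator_of_notMem (fun h => hy (hiff.mp h))]
      rw [not_and_or] at hy
      rcases hy with hy | hy <;> rw [Set.indicator_of_notMem hy] <;> simp
  simp_rw [e2]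
  rw [lintegral_indicator_const (isCompact_Icc.reProdIm isCompact_Icc).measurableSet,
    volume_reProdIm measurableSet_Icc measurableSet_Icc, volume_Icc_inter_sub,
    volume_Icc_inter_sub, sq_mul_tent_div hN]
  ring

/-! ### Pair sums of a configuration -/

namespace PointConfiguration

lemma mem_pointsInSquare (X : PointConfiguration) (N : ℕ) (x : ℂ) :
    x ∈ X.pointsInSquare N ↔ x ∈ X.carrier ∧ x ∈ square N := by
  simp [pointsInSquare, square]

/-- The sum of `f (a - b)` over the ordered pairs of distinct points in the square `[0, N]²`. -/
noncomputable def pairSum {M : Type*} [AddCommMonoid M] (N : ℕ) (f : ℂ → M) (X : PointConfiguration) : M :=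
  ∑ p ∈ (X.pointsInSquare N).offDiag, f (p.1 - p.2)

lemma tsum_embedding_two_eq_pairSum (X : PointConfiguration) (N : ℕ) (f : ℂ → ℝ≥0∞) :
    ∑' x : Fin 2 ↪ X.carrier, ((square N).indicator 1 (x 0 : ℂ) *
      (square N).indicator 1 (x 1 : ℂ) * f (x 0 - x 1)) = X.pairSum N f := by
  classical
  rw [pairSum, ← Finset.tsum_subtype (X.pointsInSquare N).offDiag fun p => f (p.1 - p.2)]
  have hmem : ∀ p : (X.pointsInSquare N).offDiag, (p.1.1 ∈ X.carrier ∧ p.1.1 ∈ square N) ∧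
      (p.1.2 ∈ X.carrier ∧ p.1.2 ∈ square N) ∧ p.1.1 ≠ p.1.2 := fun p => by
    have := Finset.mem_offDiag.mp p.2
    simpa only [mem_pointsInSquare] using this
  let i : (X.pointsInSquare N).offDiag → (Fin 2 ↪ X.carrier) := fun p =>
    ⟨![⟨p.1.1, (hmem p).1.1⟩, ⟨p.1.2, (hmem p).2.1.1⟩], by
      intro a b hab
      have hne := (hmem p).2.2
      fin_cases a <;> fin_cases b
      · rfl
      · exact absurd (congrArg Subtype.val hab) hne
      · exact absurd (congrArg Subtype.val hab).symm hne
      · rfl⟩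
  have hi0 : ∀ p, ((i p 0 : X.carrier) : ℂ) = p.1.1 := fun p => rfl
  have hi1 : ∀ p, ((i p 1 : X.carrier) : ℂ) = p.1.2 := fun p => rfl
  refine tsum_eq_tsum_of_ne_zero_bij (fun p => i p.1) ?_ ?_ ?_
  · intro p q hpq
    have h0 : p.1.1.1 = q.1.1.1 := by rw [← hi0, ← hi0]; simp only at hpq; rw [hpq]
    have h1 : p.1.1.2 = q.1.1.2 := by rw [← hi1, ← hi1]; simp only at hpq; rw [hpq]
    exact Subtype.ext (Subtype.ext (Prod.ext h0 h1))
  · intro x hx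
    rw [Function.mem_support] at hx
    have h0 : (x 0 : ℂ) ∈ square N := by
      by_contra h; apply hx; simp [Set.indicator_of_notMem h]
    have h1 : (x 1 : ℂ) ∈ square N := by
      by_contra h; apply hx; simp [Set.indicator_of_notMem h]
    have hne : (x 0 : ℂ) ≠ x 1 := fun h => by
      have := x.injective (Subtype.ext h); simp at this
    have hp : ((x 0 : ℂ), (x 1 : ℂ)) ∈ (X.pointsInSquare N).offDiag := by
      rw [Finset.mem_offDiag]
      simp only [mem_pointsInSquare]
      exact ⟨⟨(x 0).2, h0⟩, ⟨(x 1).2, h1⟩, hne⟩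
    refine ⟨⟨⟨_, hp⟩, ?_⟩, ?_⟩
    · rw [Function.mem_support]
      intro h
      apply hx
      simp only at h
      rw [h, mul_zero]
    · ext k
      fin_cases k <;> rfl
  · intro p
    rw [hi0, hi1, Set.indicator_of_mem (hmem p.1).1.2, Set.indicator_of_mem (hmem p.1).2.1.2]
    simp

lemma tsum_embedding_one_eq_card (X : PointConfiguration) (N : ℕ) :
    ∑' x : Fin 1 ↪ X.carrier, (square N).indicator (1 : ℂ → ℝ≥0∞) (x 0 : ℂ) =
      (X.pointsInSquare N).card := by
  classical
  have h : ((X.pointsInSquare N).card : ℝ≥0∞) = ∑ x ∈ X.pointsInSquare N, 1 := by simp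
  rw [h, ← Finset.tsum_subtype (X.pointsInSquare N) fun _ => (1 : ℝ≥0∞)]
  have hmem : ∀ p : X.pointsInSquare N, p.1 ∈ X.carrier ∧ p.1 ∈ square N := fun p =>
    (mem_pointsInSquare X N _).mp p.2
  let i : X.pointsInSquare N → (Fin 1 ↪ X.carrier) := fun p =>
    ⟨fun _ => ⟨p.1, (hmem p).1⟩, fun a b _ => Subsingleton.elim a b⟩
  have hi0 : ∀ p, ((i p 0 : X.carrier) : ℂ) = p.1 := fun p => rfl
  refine tsum_eq_tsum_of_ne_zero_bij (fun p => i p.1) ?_ ?_ ?_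
  · intro p q hpq
    have h0 : p.1.1 = q.1.1 := by rw [← hi0, ← hi0]; simp only at hpq; rw [hpq]
    exact Subtype.ext (Subtype.ext h0)
  · intro x hx
    rw [Function.mem_support] at hx
    have h0 : (x 0 : ℂ) ∈ square N := by
      by_contra h; apply hx; simp [Set.indicator_of_notMem h]
    refine ⟨⟨⟨x 0, (mem_pointsInSquare X N _).mpr ⟨(x 0).2, h0⟩⟩, by simp⟩, ?_⟩
    ext k
    fin_cases k
    rfl
  · intro p
    rw [hi0, Set.indicator_of_mem (hmem p.1).2]
    rfl

lemma measurable_card_pointsInSquare (N : ℕ) :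
    Measurable fun X : PointConfiguration => (X.pointsInSquare N).card := by
  have h1 : Measurable fun X : PointConfiguration => (X.carrier ∩ square N).encard := by
    rw [measurable_iff_comap_le]
    exact le_iSup₂_of_le (square N) (measurableSet_square N) le_rfl
  have h2 : (fun X : PointConfiguration => (X.pointsInSquare N).card) =
      fun X => (X.carrier ∩ square N).encard.toNat := by
    ext X
    have : (X.carrier ∩ square N) = (X.pointsInSquare N : Set ℂ) := by
      ext x; simp [mem_pointsInSquare]
    rw [this, Set.encard_coe_eq_coe_finsetCard, ENat.toNat_natCast]
  rw [h2]
  exact (measurable_of_countable ENat.toNat).comp h1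

lemma pairSum_const_one {R : Type*} [CommRing R] (X : PointConfiguration) (N : ℕ) :
    X.pairSum N (fun _ => (1 : R)) =
      (X.pointsInSquare N).card * ((X.pointsInSquare N).card - 1) := by
  rw [pairSum, Finset.sum_const, Finset.offDiag_card, nsmul_one,
    Nat.cast_sub (Nat.le_mul_self _)]
  push_cast
  ring

lemma measurable_pairSum_const (N : ℕ) (c : ℝ≥0∞) : Measurable (pairSum N fun _ => c) := by
  have : (pairSum N fun _ => c) = fun X : PointConfiguration =>
      (fun n : ℕ => (n * n - n) • c) (X.pointsInSquare N).card := by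
    ext X; rw [pairSum, Finset.sum_const, Finset.offDiag_card]
  rw [this]
  exact (measurable_of_countable fun n : ℕ => (n * n - n) • c).comp
    (measurable_card_pointsInSquare N)

lemma pairSum_nonneg {N : ℕ} {φ : ℂ → ℝ} (hφ : ∀ v, 0 ≤ φ v) (X : PointConfiguration) :
    0 ≤ pairSum N φ X := Finset.sum_nonneg fun _ _ => hφ _

lemma ofReal_pairSum {N : ℕ} {φ : ℂ → ℝ} (hφ : ∀ v, 0 ≤ φ v) (X : PointConfiguration) :
    ENNReal.ofReal (pairSum N φ X) = pairSum N (fun v => ENNReal.ofReal (φ v)) X :=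
  ENNReal.ofReal_sum_of_nonneg fun _ _ => hφ _

end PointConfiguration

open PointConfiguration

/-! ### Expectations and measurability of pair sums -/

section Correlation

variable {P : Measure PointConfiguration} {T : ℂ → ℝ}

lemma IsCorrelationFunction.measurable_of_sub
    (h : IsCorrelationFunction P 2 fun x => 1 - T (x 0 - x 1)) : Measurable T := by
  have h1 := h.measurable.comp (by fun_prop : Measurable fun v : ℂ => (![v, 0] : Fin 2 → ℂ))
  have h2 : T = fun v => 1 - ((fun x : Fin 2 → ℂ => 1 - T (x 0 - x 1)) ∘
      fun v : ℂ => (![v, 0] : Fin 2 → ℂ)) v := by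
    ext v; simp
  rw [h2]
  exact measurable_const.sub h1

lemma IsCorrelationFunction.one_sub_nonneg
    (h : IsCorrelationFunction P 2 fun x => 1 - T (x 0 - x 1)) (v : ℂ) : 0 ≤ 1 - T v := by
  simpa using h.nonneg ![v, 0]

lemma lintegral_pairSum (h : IsCorrelationFunction P 2 fun x => 1 - T (x 0 - x 1))
    {N : ℕ} (hN : 0 < N) {f : ℂ → ℝ≥0∞} (hf : Measurable f) :
    ∫⁻ X, pairSum N f X ∂P = ENNReal.ofReal ((N : ℝ) ^ 2) *
      ∫⁻ v, f v * ENNReal.ofReal (1 - T v) * ENNReal.ofReal (tent (v / N)) := by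
  have hT := h.measurable_of_sub
  have hm : Measurable ((square N).indicator (1 : ℂ → ℝ≥0∞)) :=
    measurable_one.indicator (measurableSet_square N)
  have hg : Measurable fun v => f v * ENNReal.ofReal (1 - T v) :=
    hf.mul (measurable_const.sub hT).ennreal_ofReal
  rw [← lintegral_square_square_sub hN hg]
  have h1 := h.lintegral_eq (fun x => (square N).indicator 1 (x 0) * (square N).indicator 1 (x 1) *
    f (x 0 - x 1)) (((hm.comp (measurable_pi_apply 0)).mul (hm.comp (measurable_pi_apply 1))).mul
      (hf.comp ((measurable_pi_apply 0).sub (measurable_pi_apply 1))))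
  simp_rw [tsum_embedding_two_eq_pairSum] at h1
  rw [h1]
  have hG : Measurable fun p : ℂ × ℂ => (square N).indicator (1 : ℂ → ℝ≥0∞) p.1 *
      (square N).indicator 1 p.2 * (f (p.1 - p.2) * ENNReal.ofReal (1 - T (p.1 - p.2))) :=
    ((hm.comp measurable_fst).mul (hm.comp measurable_snd)).mul
      (hg.comp (measurable_fst.sub measurable_snd))
  have h2 := (volume_preserving_finTwoArrow ℂ).lintegral_comp hG
  rw [Measure.volume_eq_prod, lintegral_prod _ hG.aemeasurable] at h2
  rw [← h2]
  refine lintegral_congr fun x => ?_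
  simp only [MeasurableEquiv.finTwoArrow_apply, mul_assoc]

lemma lintegral_pairSum_one_lt_top (h : IsCorrelationFunction P 2 fun x => 1 - T (x 0 - x 1))
    (N : ℕ) : ∫⁻ X, pairSum N (fun _ => (1 : ℝ≥0∞)) X ∂P < ∞ := by
  have hm : Measurable ((square N).indicator (1 : ℂ → ℝ≥0∞)) :=
    measurable_one.indicator (measurableSet_square N)
  have h1 := h.lintegral_eq (fun x => (square N).indicator 1 (x 0) * (square N).indicator 1 (x 1) *
    (fun _ => 1) (x 0 - x 1)) (((hm.comp (measurable_pi_apply 0)).mul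
      (hm.comp (measurable_pi_apply 1))).mul measurable_const)
  rw [lintegral_congr fun X => (tsum_embedding_two_eq_pairSum X N fun _ => 1).symm, h1]
  have hK : IsCompact (Set.univ.pi fun _ : Fin 2 => square N) :=
    isCompact_univ_pi fun _ => isCompact_square N
  have h2 := (h.locallyIntegrable.integrableOn_isCompact hK).lintegral_lt_top
  refine lt_of_le_of_lt ?_ h2
  rw [← lintegral_indicator hK.measurableSet]
  refine lintegral_mono fun x => ?_
  by_cases h0 : x 0 ∈ square N
  · by_cases h1 : x 1 ∈ square N
    · have : x ∈ Set.univ.pi fun _ : Fin 2 => square N := by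
        intro i _; fin_cases i <;> assumption
      rw [Set.indicator_of_mem this, Set.indicator_of_mem h0, Set.indicator_of_mem h1]
      simp
    · simp [Set.indicator_of_notMem h1]
  · simp [Set.indicator_of_notMem h0]

/-- The σ-algebra is only known through counts, so measurability is extracted from the correlation
identity. The lower integrals of the pair sums of f and n - f add up to the finite integral of the
pair sum of n, which depends on a count alone. Measurable minorants attaining the two lower
integrals must then add up to that sum almost everywhere, so each equals the pair sum it bounds. -/
lemma aemeasurable_pairSum_of_le (h : IsCorrelationFunction P 2 fun x => 1 - T (x 0 - x 1))
    {N : ℕ} (hN : 0 < N) {f : ℂ → ℝ≥0∞} (hf : Measurable f) (n : ℕ) (hfn : ∀ v, f v ≤ n) :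
    AEMeasurable (pairSum N f) P := by
  have hg : Measurable fun v => (n : ℝ≥0∞) - f v := measurable_const.sub hf
  have hadd : ∀ X, pairSum N f X + pairSum N (fun v => (n : ℝ≥0∞) - f v) X =
      pairSum N (fun _ => (n : ℝ≥0∞)) X := by
    intro X
    simp only [pairSum]
    rw [← Finset.sum_add_distrib]
    exact Finset.sum_congr rfl fun p _ => add_tsub_cancel_of_le (hfn _)
  have hfin : ∫⁻ X, pairSum N (fun _ => (n : ℝ≥0∞)) X ∂P < ∞ := by
    have e : ∀ X, pairSum N (fun _ => (n : ℝ≥0∞)) X = n * pairSum N (fun _ => (1 : ℝ≥0∞)) X := by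
      intro X; simp only [pairSum, Finset.mul_sum, mul_one]
    simp_rw [e]
    rw [lintegral_const_mul' _ _ (ENNReal.natCast_ne_top n)]
    exact ENNReal.mul_lt_top (ENNReal.natCast_lt_top n) (lintegral_pairSum_one_lt_top h N)
  have hfm : Measurable fun v : ℂ =>
      f v * ENNReal.ofReal (1 - T v) * ENNReal.ofReal (tent (v / N)) :=
    (hf.mul (measurable_const.sub h.measurable_of_sub).ennreal_ofReal).mul
      (continuous_tent.measurable.comp (measurable_id.div_const _)).ennreal_ofReal
  have hint : ∫⁻ X, pairSum N f X ∂P + ∫⁻ X, pairSum N (fun v => (n : ℝ≥0∞) - f v) X ∂P =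
      ∫⁻ X, pairSum N (fun _ => (n : ℝ≥0∞)) X ∂P := by
    rw [lintegral_pairSum h hN hf, lintegral_pairSum h hN hg, lintegral_pairSum h hN
      measurable_const, ← mul_add, ← lintegral_add_left hfm]
    congr 1
    refine lintegral_congr fun v => ?_
    rw [← add_mul, ← add_mul, add_tsub_cancel_of_le (hfn v)]
  obtain ⟨g₁, hg₁m, hg₁le, hg₁⟩ := exists_measurable_le_lintegral_eq P (pairSum N f)
  obtain ⟨g₂, hg₂m, hg₂le, hg₂⟩ := exists_measurable_le_lintegral_eq P
    (pairSum N fun v => (n : ℝ≥0∞) - f v)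
  have hsum : ∫⁻ X, (g₁ X + g₂ X) ∂P = ∫⁻ X, pairSum N (fun _ => (n : ℝ≥0∞)) X ∂P := by
    rw [lintegral_add_left hg₁m, ← hg₁, ← hg₂, hint]
  have hle : ∀ X, g₁ X + g₂ X ≤ pairSum N (fun _ => (n : ℝ≥0∞)) X := fun X => by
    rw [← hadd]; exact add_le_add (hg₁le X) (hg₂le X)
  have hae := ae_eq_of_ae_le_of_lintegral_le (Eventually.of_forall hle) (hsum ▸ hfin.ne)
    (measurable_pairSum_const N n).aemeasurable hsum.ge
  refine ⟨g₁, hg₁m, ?_⟩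
  filter_upwards [hae, ae_lt_top (measurable_pairSum_const N n) hfin.ne] with X hX hX'
  refine le_antisymm ?_ (hg₁le X)
  rw [← hadd X] at hX hX'
  have h2 : pairSum N (fun v => (n : ℝ≥0∞) - f v) X ≠ ∞ :=
    (lt_of_le_of_lt le_add_self hX').ne
  refine (ENNReal.add_le_add_iff_right h2).mp ?_
  rw [← hX]
  exact add_le_add le_rfl (hg₂le X)

/-- Truncate f at height n and let n tend to infinity. -/
lemma aemeasurable_pairSum (h : IsCorrelationFunction P 2 fun x => 1 - T (x 0 - x 1))
    {N : ℕ} (hN : 0 < N) {f : ℂ → ℝ≥0∞} (hf : Measurable f) : AEMeasurable (pairSum N f) P := by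
  refine aemeasurable_of_tendsto_metrizable_ae atTop
    (f := fun n : ℕ => pairSum N fun v => min (f v) n)
    (fun n => aemeasurable_pairSum_of_le h hN (hf.min measurable_const) n fun v => min_le_right _ _)
    (Eventually.of_forall fun X => tendsto_finsetSum _ fun p _ => ?_)
  simpa using (tendsto_const_nhds (x := f (p.1 - p.2))).min ENNReal.tendsto_nat_nhds_top

lemma lintegral_ofReal_pairSum (h : IsCorrelationFunction P 2 fun x => 1 - T (x 0 - x 1))
    {N : ℕ} (hN : 0 < N) {φ : ℂ → ℝ} (hφ : Measurable φ) (hφ0 : ∀ v, 0 ≤ φ v) :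
    ∫⁻ X, ENNReal.ofReal (pairSum N φ X) ∂P = ENNReal.ofReal ((N : ℝ) ^ 2) *
      ∫⁻ v, ENNReal.ofReal (φ v * (1 - T v) * tent (v / N)) := by
  simp_rw [ofReal_pairSum hφ0]
  rw [lintegral_pairSum h hN hφ.ennreal_ofReal]
  congr 1
  refine lintegral_congr fun v => ?_
  rw [ENNReal.ofReal_mul (mul_nonneg (hφ0 v) (h.one_sub_nonneg v)), ENNReal.ofReal_mul (hφ0 v)]

lemma aemeasurable_pairSum_real (h : IsCorrelationFunction P 2 fun x => 1 - T (x 0 - x 1))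
    {N : ℕ} (hN : 0 < N) {φ : ℂ → ℝ} (hφ : Measurable φ) (hφ0 : ∀ v, 0 ≤ φ v) :
    AEMeasurable (pairSum N φ) P := by
  have e : pairSum N φ = fun X => (pairSum N (fun v => ENNReal.ofReal (φ v)) X).toReal := by
    ext X
    rw [← ofReal_pairSum hφ0, ENNReal.toReal_ofReal (pairSum_nonneg hφ0 X)]
  rw [e]
  exact (aemeasurable_pairSum h hN hφ.ennreal_ofReal).ennreal_toReal

lemma integrable_pairSum_iff (h : IsCorrelationFunction P 2 fun x => 1 - T (x 0 - x 1))
    {N : ℕ} (hN : 0 < N) {φ : ℂ → ℝ} (hφ : Measurable φ) (hφ0 : ∀ v, 0 ≤ φ v) :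
    Integrable (pairSum N φ) P ↔ Integrable fun v => φ v * (1 - T v) * tent (v / N) := by
  have hm : Measurable fun v : ℂ => φ v * (1 - T v) * tent (v / N) :=
    (hφ.mul (measurable_const.sub h.measurable_of_sub)).mul
      (continuous_tent.measurable.comp (measurable_id.div_const _))
  have h0 : ∀ v : ℂ, 0 ≤ φ v * (1 - T v) * tent (v / N) := fun v =>
    mul_nonneg (mul_nonneg (hφ0 v) (h.one_sub_nonneg v)) (tent_nonneg _)
  rw [Integrable, Integrable, and_iff_right (aemeasurable_pairSum_real h hN hφ hφ0).aestronglyMeasurable,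
    and_iff_right hm.aestronglyMeasurable, hasFiniteIntegral_iff_ofReal (Eventually.of_forall
      (pairSum_nonneg hφ0)),
    hasFiniteIntegral_iff_ofReal (Eventually.of_forall h0), lintegral_ofReal_pairSum h hN hφ hφ0]
  have hN2 : ENNReal.ofReal ((N : ℝ) ^ 2) ≠ 0 := by
    rw [Ne, ENNReal.ofReal_eq_zero, not_le]; positivity
  rw [ENNReal.mul_lt_top_iff]
  constructor
  · rintro (⟨-, h⟩ | h | h)
    · exact h
    · exact absurd h hN2
    · rw [h]; exact ENNReal.zero_lt_top
  · intro h; exact Or.inl ⟨ENNReal.ofReal_lt_top, h⟩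

lemma integral_pairSum (h : IsCorrelationFunction P 2 fun x => 1 - T (x 0 - x 1))
    {N : ℕ} (hN : 0 < N) {φ : ℂ → ℝ} (hφ : Measurable φ) (hφ0 : ∀ v, 0 ≤ φ v) :
    ∫ X, pairSum N φ X ∂P = (N : ℝ) ^ 2 * ∫ v, φ v * (1 - T v) * tent (v / N) := by
  have hm : Measurable fun v : ℂ => φ v * (1 - T v) * tent (v / N) :=
    (hφ.mul (measurable_const.sub h.measurable_of_sub)).mul
      (continuous_tent.measurable.comp (measurable_id.div_const _))
  have h0 : ∀ v : ℂ, 0 ≤ φ v * (1 - T v) * tent (v / N) := fun v =>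
    mul_nonneg (mul_nonneg (hφ0 v) (h.one_sub_nonneg v)) (tent_nonneg _)
  rw [integral_eq_lintegral_of_nonneg_ae (Eventually.of_forall (pairSum_nonneg hφ0))
    (aemeasurable_pairSum_real h hN hφ hφ0).aestronglyMeasurable,
    integral_eq_lintegral_of_nonneg_ae (Eventually.of_forall h0) hm.aestronglyMeasurable,
    lintegral_ofReal_pairSum h hN hφ hφ0, ENNReal.toReal_mul,
    ENNReal.toReal_ofReal (by positivity)]

end Correlation

/-! ### Rescaling and integrability of the kernel -/

lemma div_natCast_eq_smul (N : ℕ) (v : ℂ) : v / N = (N : ℝ)⁻¹ • v := by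
  rw [Complex.real_smul, Complex.ofReal_inv, Complex.ofReal_natCast, div_eq_inv_mul]

lemma integrable_comp_div_natCast {f : ℂ → ℝ} (hf : Integrable f) {N : ℕ} (hN : 0 < N) :
    Integrable fun v : ℂ => f (v / N) := by
  simp_rw [div_natCast_eq_smul]
  exact hf.comp_smul (inv_ne_zero (Nat.cast_ne_zero.mpr hN.ne'))

lemma integral_comp_div_natCast (f : ℂ → ℝ) (N : ℕ) :
    ∫ v : ℂ, f (v / N) = (N : ℝ) ^ 2 * ∫ v, f v := by
  simp_rw [div_natCast_eq_smul]
  rw [Measure.integral_comp_inv_smul, Complex.finrank_real_complex, smul_eq_mul,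
    abs_of_nonneg (by positivity)]

lemma integral_tent : ∫ z, tent z = 1 := by
  have h1 : ∫ x : ℝ, max 0 (1 - |x|) = 1 := by
    have := integral_max_zero_mul_comp_abs fun _ => 1
    simp only [mul_one] at this
    rw [this, intervalIntegral.integral_sub (by simp) (by simp), integral_id]
    norm_num
  have h2 := integral_prod_mul (μ := volume) (ν := volume) (fun x : ℝ => max 0 (1 - |x|))
    (fun x : ℝ => max 0 (1 - |x|))
  rw [h1, mul_one, ← Measure.volume_eq_prod] at h2
  rw [← h2]
  exact (Complex.volume_preserving_equiv_real_prod.integral_comp'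
    (g := fun z : ℝ × ℝ => max 0 (1 - |z.1|) * max 0 (1 - |z.2|)))

lemma tendsto_div_natCast (v : ℂ) : Tendsto (fun N : ℕ => v / (N : ℂ)) atTop (𝓝 0) :=
  tendsto_const_div_atTop_nhds_zero_nat v

lemma tendsto_tent_div (v : ℂ) : Tendsto (fun N : ℕ => tent (v / N)) atTop (𝓝 1) :=
  (continuous_tent.tendsto' 0 1 (by simp [tent])).comp (tendsto_div_natCast v)

lemma measurable_comp_div_natCast {f : ℂ → ℝ} (hf : Measurable f) (N : ℕ) :
    Measurable fun v : ℂ => f (v / N) := hf.comp (measurable_id.div_const _)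

lemma quarter_le_tent_div {N : ℕ} (hN : 2 ≤ N) {v : ℂ} (hv : ‖v‖ ≤ 1) : 1 / 4 ≤ tent (v / N) := by
  have hN' : (2 : ℝ) ≤ N := by exact_mod_cast hN
  have key : ∀ x : ℝ, |x| ≤ 1 → 1 / 2 ≤ max 0 (1 - |x / N|) := by
    intro x hx
    refine le_max_of_le_right ?_
    rw [abs_div, abs_of_pos (by linarith : (0 : ℝ) < N)]
    have : |x| / N ≤ 1 / 2 := by
      rw [div_le_div_iff₀ (by linarith) two_pos]; linarith
    linarith
  rw [tent, Complex.div_natCast_re, Complex.div_natCast_im]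
  have h1 := key v.re ((Complex.abs_re_le_norm v).trans hv)
  have h2 := key v.im ((Complex.abs_im_le_norm v).trans hv)
  nlinarith

lemma integrable_iff_of_ae_eq_sub_const_mul {α : Type*} [MeasurableSpace α] {μ : Measure α}
    {F G H : α → ℝ} {c : ℝ} (hc : c ≠ 0) (hG : Integrable G μ)
    (hF : F =ᵐ[μ] fun v => G v - c * H v) : Integrable F μ ↔ Integrable H μ := by
  rw [integrable_congr hF]
  constructor
  · intro h
    refine ((hG.sub h).const_mul c⁻¹).congr (Eventually.of_forall fun v => ?_)
    simp only [Pi.sub_apply]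
    field_simp
    ring
  · intro h
    exact hG.sub (h.const_mul c)

lemma integrable_bdd_mul_of_measurable {g T : ℂ → ℝ} (hT : Integrable T) (hg : Measurable g) {C : ℝ}
    (hC : ∀ v, |g v| ≤ C) : Integrable fun v => g v * T v :=
  hT.bdd_mul hg.aestronglyMeasurable (Eventually.of_forall hC)

lemma integrable_tent_div_mul {T : ℂ → ℝ} (hT : Integrable T) (N : ℕ) :
    Integrable fun v : ℂ => tent (v / N) * T v :=
  integrable_bdd_mul_of_measurable hT (measurable_comp_div_natCast continuous_tent.measurable N)
    (C := 1) fun v => by rw [abs_of_nonneg (tent_nonneg _)]; exact tent_le_one _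

lemma integrable_tent_div_mul_kroneckerRem {T : ℂ → ℝ} (hT : Integrable T) (N : ℕ) :
    Integrable fun v : ℂ => tent (v / N) * kroneckerRem (v / N) * T v := by
  obtain ⟨C, -, hC⟩ := exists_abs_tent_mul_kroneckerRem_le
  exact integrable_bdd_mul_of_measurable hT (measurable_comp_div_natCast
    (continuous_tent.measurable.mul measurable_kroneckerRem) N) fun v => hC _

/-- The tent is at least 1/4 on the unit disc when N ≥ 2, and outside the disc log‖v‖ ≤ ‖v‖ is
handled by the first moment. So the tent does not affect integrability. -/
lemma integrable_tent_div_mul_log_iff {T : ℂ → ℝ} (hTm : Measurable T)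
    (hT1 : Integrable fun v : ℂ => ‖v‖ * |T v|) {N : ℕ} (hN : 2 ≤ N) :
    Integrable (fun v : ℂ => tent (v / N) * (Real.log ‖v‖ * T v)) ↔
      Integrable fun v : ℂ => Real.log ‖v‖ * T v := by
  constructor
  · intro h
    refine ((h.norm.const_mul 4).add hT1).mono' ((Real.measurable_log.comp measurable_norm).mul
      hTm).aestronglyMeasurable (Eventually.of_forall fun v => ?_)
    simp only [Pi.add_apply, norm_mul, Real.norm_eq_abs]
    have h0 : 0 ≤ |Real.log ‖v‖| * |T v| := by positivity
    rw [abs_of_nonneg (tent_nonneg _)]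
    rcases le_total ‖v‖ 1 with hv | hv
    · have := quarter_le_tent_div hN hv
      have h3 : 0 ≤ ‖v‖ * |T v| := by positivity
      nlinarith
    · have h1 : |Real.log ‖v‖| ≤ ‖v‖ := by
        rw [abs_of_nonneg (Real.log_nonneg hv)]
        exact Real.log_le_self (norm_nonneg _)
      have h2 : 0 ≤ tent (v / N) * (|Real.log ‖v‖| * |T v|) := mul_nonneg (tent_nonneg _) h0
      have h3 := mul_le_mul_of_nonneg_right h1 (abs_nonneg (T v))
      linarith
  · intro h
    exact integrable_tent_div_mul h N

lemma kroneckerPlane_div {N : ℕ} (hN : 0 < N) {v : ℂ} (hv : v ≠ 0) :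
    kroneckerPlane (v / N) = kroneckerRem (v / N) -
      2 * Real.pi * (Real.log ‖v‖ - Real.log (N / etaConst)) := by
  have hN' : (N : ℝ) ≠ 0 := Nat.cast_ne_zero.mpr hN.ne'
  rw [kroneckerRem, norm_div, Complex.norm_natCast, Real.log_div (norm_ne_zero_iff.mpr hv) hN',
    Real.log_div hN' etaConst_pos.ne']
  ring

lemma tent_mul_kroneckerPlane_mul_ae_eq {N : ℕ} (hN : 0 < N) (T : ℂ → ℝ) :
    (fun v : ℂ => tent (v / N) * kroneckerPlane (v / N) * T v) =ᵐ[volume] fun v =>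
      (tent (v / N) * kroneckerRem (v / N) * T v +
        2 * Real.pi * Real.log (N / etaConst) * (tent (v / N) * T v)) -
      2 * Real.pi * (tent (v / N) * (Real.log ‖v‖ * T v)) := by
  filter_upwards [Measure.ae_ne volume (0 : ℂ)] with v hv
  rw [kroneckerPlane_div hN hv]
  ring

lemma integrable_tent_mul_kroneckerPlane_mul_iff {T : ℂ → ℝ} (hT : Integrable T)
    (hTm : Measurable T) (hT1 : Integrable fun v : ℂ => ‖v‖ * |T v|) {N : ℕ} (hN : 2 ≤ N) :
    Integrable (fun v : ℂ => tent (v / N) * kroneckerPlane (v / N) * T v) ↔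
      Integrable fun v : ℂ => Real.log ‖v‖ * T v := by
  rw [← integrable_tent_div_mul_log_iff hTm hT1 hN]
  exact integrable_iff_of_ae_eq_sub_const_mul (by positivity)
    ((integrable_tent_div_mul_kroneckerRem hT N).add ((integrable_tent_div_mul hT N).const_mul _))
    (tent_mul_kroneckerPlane_mul_ae_eq (by omega) T)

/-! ### The expected energy at finite N -/

section Correlation

variable {P : Measure PointConfiguration} {T : ℂ → ℝ}

/-- The first moment gives integrability only away from the origin. On the unit disc it comes from
the local integrability of the two-point function, through the finite mean number of pairs in
[0,2]². -/
lemma integrable_of_isCorrelationFunction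
    (h : IsCorrelationFunction P 2 fun x => 1 - T (x 0 - x 1))
    (hT1 : Integrable fun v : ℂ => ‖v‖ * |T v|) : Integrable T := by
  have hTm := h.measurable_of_sub
  have h1 : Integrable fun v : ℂ => (fun _ => (1 : ℝ)) v * (1 - T v) * tent (v / (2 : ℕ)) := by
    rw [← integrable_pairSum_iff h two_pos measurable_const fun _ => zero_le_one]
    refine ⟨(aemeasurable_pairSum_real h two_pos measurable_const
      fun _ => zero_le_one).aestronglyMeasurable, ?_⟩
    rw [hasFiniteIntegral_iff_ofReal (Eventually.of_forall (pairSum_nonneg fun _ => zero_le_one))]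
    simp_rw [ofReal_pairSum (φ := fun _ => (1 : ℝ)) fun _ => zero_le_one, ENNReal.ofReal_one]
    exact lintegral_pairSum_one_lt_top h 2
  have h2 := integrable_comp_div_natCast integrable_tent (two_pos : 0 < 2)
  refine (((h1.norm.add h2).const_mul 4).add hT1).mono' hTm.aestronglyMeasurable
    (Eventually.of_forall fun v => ?_)
  have h0 := tent_nonneg (v / (2 : ℕ))
  have hn : 0 ≤ ‖v‖ * |T v| := by positivity
  have ha := abs_nonneg (1 - T v)
  simp only [Pi.add_apply, norm_mul, one_mul, Real.norm_eq_abs]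
  rw [abs_of_nonneg h0]
  rcases le_total ‖v‖ 1 with hv | hv
  · have h3 := quarter_le_tent_div le_rfl hv
    have h4 : |T v| ≤ |1 - T v| + 1 := by
      have := abs_sub_abs_le_abs_sub (T v) 1
      rw [abs_one, abs_sub_comm] at this
      linarith
    nlinarith
  · have h3 := mul_le_mul_of_nonneg_right hv (abs_nonneg (T v))
    nlinarith [mul_nonneg ha h0]

lemma eisensteinN_eq_kroneckerPlane {N : ℕ} {x : ℂ} (h0 : x.im ≠ 0) (hN : |x.im| < N) :
    eisensteinN N x = kroneckerPlane (x / N) := by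
  have hN' : (0 : ℝ) < N := (abs_nonneg _).trans_lt hN
  have him : |(x / N).im| < 1 := by
    rw [Complex.div_natCast_im, abs_div, abs_of_pos hN', div_lt_one hN']
    exact hN
  have him0 : (x / N).im ≠ 0 := by
    rw [Complex.div_natCast_im]; exact div_ne_zero h0 hN'.ne'
  rw [eisensteinN, eisensteinUV_re_eq him0 him, kroneckerPlane, min_eq_left him.le]

lemma volume_im_preimage_finite {s : Set ℝ} (hs : s.Finite) : volume {v : ℂ | v.im ∈ s} = 0 := by
  have h : {v : ℂ | v.im ∈ s} = Set.univ ×ℂ s := by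
    ext v; simp [Complex.mem_reProdIm]
  rw [h, volume_reProdIm MeasurableSet.univ hs.measurableSet, hs.measure_zero, mul_zero]

lemma ae_pairSum_eisensteinN_eq (h : IsCorrelationFunction P 2 fun x => 1 - T (x 0 - x 1))
    {N : ℕ} (hN : 0 < N) :
    pairSum N (eisensteinN N) =ᵐ[P] pairSum N fun v => kroneckerPlane (v / N) := by
  -- Differences on these lines are the ones the limit formula misses. They form a null set, so the
  -- expected number of such pairs is 0.
  set Z : Set ℂ := {v : ℂ | v.im ∈ ({0, (N : ℝ), -(N : ℝ)} : Set ℝ)} with hZ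
  have hfin : ({0, (N : ℝ), -(N : ℝ)} : Set ℝ).Finite := Set.toFinite _
  have hZm : MeasurableSet Z := Complex.measurable_im hfin.measurableSet
  have hf : Measurable (Z.indicator (1 : ℂ → ℝ≥0∞)) := measurable_one.indicator hZm
  have h0 : ∫⁻ X, pairSum N (Z.indicator (1 : ℂ → ℝ≥0∞)) X ∂P = 0 := by
    rw [lintegral_pairSum h hN hf]
    have hz : ∀ᵐ v : ℂ, v ∉ Z := measure_eq_zero_iff_ae_notMem.mp (volume_im_preimage_finite hfin)
    rw [lintegral_congr_ae (g := fun _ => 0), lintegral_zero, mul_zero]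
    filter_upwards [hz] with v hv
    rw [Set.indicator_of_notMem hv, zero_mul, zero_mul]
  rw [lintegral_eq_zero_iff' (aemeasurable_pairSum h hN hf)] at h0
  filter_upwards [h0] with X hX
  refine Finset.sum_congr rfl fun p hp => ?_
  have hpz : p.1 - p.2 ∉ Z := by
    intro hmem
    have h1 := (Finset.sum_eq_zero_iff.mp hX) p hp
    rw [Set.indicator_of_mem hmem] at h1
    exact one_ne_zero h1
  rw [Finset.mem_offDiag, mem_pointsInSquare, mem_pointsInSquare] at hp
  have h1 := hp.1.2.2
  have h2 := hp.2.1.2.2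
  simp only [Set.mem_preimage, Set.mem_Icc] at h1 h2
  simp only [hZ, Set.mem_ofPred_eq, Set.mem_insert_iff, Set.mem_singleton_iff, not_or] at hpz
  refine eisensteinN_eq_kroneckerPlane hpz.1 (lt_of_le_of_ne ?_ ?_)
  · rw [Complex.sub_im, abs_le]; constructor <;> linarith
  · intro he
    rcases abs_choice (p.1 - p.2).im with hc | hc
    · exact hpz.2.1 (by rw [← hc, he])
    · exact hpz.2.2 (by linarith)

lemma renormalizedEnergy_eq (N : ℕ) (X : PointConfiguration) :
    renormalizedEnergy N X = 1 / (2 * Real.pi * (N : ℝ) ^ 2) * pairSum N (eisensteinN N) X +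
      Real.log (N / etaConst) := rfl

lemma extendedExpectation_congr {Ω : Type*} [MeasurableSpace Ω] {μ : Measure Ω} {f g : Ω → ℝ}
    (h : f =ᵐ[μ] g) : extendedExpectation μ f = extendedExpectation μ g := by
  rw [extendedExpectation, extendedExpectation,
    lintegral_congr_ae (h.mono fun x hx => by simp only [hx] :
      (fun x => ENNReal.ofReal (f x)) =ᵐ[μ] fun x => ENNReal.ofReal (g x)),
    lintegral_congr_ae (h.mono fun x hx => by simp only [hx] :
      (fun x => ENNReal.ofReal (-f x)) =ᵐ[μ] fun x => ENNReal.ofReal (-g x))]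

lemma extendedExpectation_of_integrable {Ω : Type*} [MeasurableSpace Ω] {μ : Measure Ω} {f : Ω → ℝ}
    (h : Integrable f μ) : extendedExpectation μ f = ((∫ x, f x ∂μ : ℝ) : EReal) := by
  have h1 : ∫⁻ x, ENNReal.ofReal (f x) ∂μ ≠ ∞ := h.lintegral_lt_top.ne
  have h2 : ∫⁻ x, ENNReal.ofReal (-f x) ∂μ ≠ ∞ := h.neg.lintegral_lt_top.ne
  rw [extendedExpectation, integral_eq_lintegral_pos_part_sub_lintegral_neg_part h, EReal.coe_sub,
    EReal.coe_ennreal_toReal h1, EReal.coe_ennreal_toReal h2]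

lemma extendedExpectation_sub_eq_top {Ω : Type*} [MeasurableSpace Ω] {μ : Measure Ω} {f g : Ω → ℝ}
    (hf0 : ∀ x, 0 ≤ f x) (hfm : AEMeasurable f μ) (hf : ¬ Integrable f μ) (hg : Integrable g μ) :
    extendedExpectation μ (fun x => f x - g x) = ⊤ := by
  have hneg : ∫⁻ x, ENNReal.ofReal (-(f x - g x)) ∂μ ≠ ∞ := by
    refine (lt_of_le_of_lt (lintegral_mono fun x => ?_) hg.abs.lintegral_lt_top).ne
    exact ENNReal.ofReal_le_ofReal (by linarith [hf0 x, le_abs_self (g x)])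
  have hpos : ∫⁻ x, ENNReal.ofReal (f x - g x) ∂μ = ∞ := by
    by_contra hne
    apply hf
    refine ⟨hfm.aestronglyMeasurable, ?_⟩
    rw [hasFiniteIntegral_iff_ofReal (Eventually.of_forall hf0)]
    calc ∫⁻ x, ENNReal.ofReal (f x) ∂μ
        ≤ ∫⁻ x, (ENNReal.ofReal (f x - g x) + ENNReal.ofReal |g x|) ∂μ := by
          refine lintegral_mono fun x => ?_
          rw [← ENNReal.ofReal_toReal (ENNReal.add_ne_top.mpr
            ⟨ENNReal.ofReal_ne_top, ENNReal.ofReal_ne_top⟩)]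
          refine ENNReal.ofReal_le_ofReal ?_
          rw [ENNReal.toReal_add ENNReal.ofReal_ne_top ENNReal.ofReal_ne_top,
            ENNReal.toReal_ofReal (abs_nonneg _), ENNReal.toReal_ofReal']
          linarith [le_max_left (f x - g x) 0, le_abs_self (g x)]
      _ = ∫⁻ x, ENNReal.ofReal (f x - g x) ∂μ + ∫⁻ x, ENNReal.ofReal |g x| ∂μ :=
          lintegral_add_right' _ hg.abs.aemeasurable.ennreal_ofReal
      _ < ∞ := ENNReal.add_lt_top.mpr ⟨lt_top_iff_ne_top.mpr hne, hg.abs.lintegral_lt_top⟩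
  rw [extendedExpectation, hpos, EReal.coe_ennreal_top, ← EReal.coe_ennreal_toReal hneg,
    EReal.top_sub_coe]

lemma pairSum_add_const {N : ℕ} (φ : ℂ → ℝ) (c : ℝ) (X : PointConfiguration) :
    pairSum N (fun v => φ v + c) X = pairSum N φ X + c * pairSum N (fun _ => (1 : ℝ)) X := by
  simp only [pairSum, Finset.sum_add_distrib, Finset.mul_sum, mul_one]

lemma integrable_pairSum_one (h : IsCorrelationFunction P 2 fun x => 1 - T (x 0 - x 1))
    (hT : Integrable T) {N : ℕ} (hN : 0 < N) :
    Integrable (pairSum N fun _ => (1 : ℝ)) P := by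
  rw [integrable_pairSum_iff h hN measurable_const fun _ => zero_le_one]
  refine ((integrable_comp_div_natCast integrable_tent hN).sub
    (integrable_tent_div_mul hT N)).congr (Eventually.of_forall fun v => ?_)
  simp only [Pi.sub_apply]
  ring

lemma integral_pairSum_one (h : IsCorrelationFunction P 2 fun x => 1 - T (x 0 - x 1))
    (hT : Integrable T) {N : ℕ} (hN : 0 < N) :
    ∫ X, pairSum N (fun _ => (1 : ℝ)) X ∂P =
      (N : ℝ) ^ 2 * ((N : ℝ) ^ 2 - ∫ v : ℂ, tent (v / N) * T v) := by
  rw [integral_pairSum h hN measurable_const fun _ => zero_le_one]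
  have e : ∀ v : ℂ, 1 * (1 - T v) * tent (v / N) = tent (v / N) - tent (v / N) * T v :=
    fun v => by ring
  simp_rw [e]
  rw [integral_sub (integrable_comp_div_natCast integrable_tent hN) (integrable_tent_div_mul hT N),
    integral_comp_div_natCast tent, integral_tent, mul_one]

variable [IsProbabilityMeasure P]

/-- The number n of points in [0,N]² has mean N², and its variance is N² times one minus the
integral on the left. -/
lemma integral_tent_mul_le_one (h₁ : IsCorrelationFunction P 1 fun _ => 1)
    (h : IsCorrelationFunction P 2 fun x => 1 - T (x 0 - x 1)) (hT : Integrable T) {N : ℕ}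
    (hN : 0 < N) : ∫ v : ℂ, tent (v / N) * T v ≤ 1 := by
  set n : PointConfiguration → ℝ := fun X => (X.pointsInSquare N).card with hn
  have hN' : (0 : ℝ) < N := Nat.cast_pos.mpr hN
  have hnm : Measurable n := (measurable_of_countable fun k : ℕ => (k : ℝ)).comp
    (measurable_card_pointsInSquare N)
  have hlin : ∫⁻ X, ENNReal.ofReal (n X) ∂P = ENNReal.ofReal ((N : ℝ) ^ 2) := by
    have hm : Measurable ((square N).indicator (1 : ℂ → ℝ≥0∞)) :=
      measurable_one.indicator (measurableSet_square N)
    have h2 := h₁.lintegral_eq (fun x => (square N).indicator 1 (x 0))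
      (hm.comp (measurable_pi_apply 0))
    simp_rw [tsum_embedding_one_eq_card, ENNReal.ofReal_one, mul_one] at h2
    have h3 := (volume_preserving_funUnique (Fin 1) ℂ).lintegral_comp hm
    have h4 : ∫⁻ a : Fin 1 → ℂ, (square N).indicator (1 : ℂ → ℝ≥0∞) (a 0) =
        ∫⁻ b : ℂ, (square N).indicator (1 : ℂ → ℝ≥0∞) b := h3
    rw [h4, lintegral_indicator_one (measurableSet_square N), volume_square] at h2
    rw [← h2]
    exact lintegral_congr fun X => ENNReal.ofReal_natCast _
  have hni : Integrable n P := by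
    refine ⟨hnm.aestronglyMeasurable, ?_⟩
    rw [hasFiniteIntegral_iff_ofReal (Eventually.of_forall fun X => Nat.cast_nonneg _), hlin]
    exact ENNReal.ofReal_lt_top
  have hnint : ∫ X, n X ∂P = (N : ℝ) ^ 2 := by
    rw [integral_eq_lintegral_of_nonneg_ae (Eventually.of_forall fun X => Nat.cast_nonneg _)
      hnm.aestronglyMeasurable, hlin, ENNReal.toReal_ofReal (by positivity)]
  have hvar : 0 ≤ ∫ X, (n X - (N : ℝ) ^ 2) ^ 2 ∂P := integral_nonneg fun X => sq_nonneg _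
  have e : ∀ X, (n X - (N : ℝ) ^ 2) ^ 2 = pairSum N (fun _ => (1 : ℝ)) X +
      ((1 - 2 * (N : ℝ) ^ 2) * n X + (N : ℝ) ^ 4) := by
    intro X; rw [pairSum_const_one]; simp only [hn]; ring
  simp_rw [e] at hvar
  have hlinear : Integrable (fun X => (1 - 2 * (N : ℝ) ^ 2) * n X + (N : ℝ) ^ 4) P :=
    (hni.const_mul _).add (integrable_const _)
  rw [integral_add (integrable_pairSum_one h hT hN) hlinear,
    integral_add (hni.const_mul _) (integrable_const _), integral_const_mul, hnint,
    integral_pairSum_one h hT hN, integral_const, probReal_univ, one_smul] at hvar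
  by_contra hlt
  rw [not_le] at hlt
  nlinarith [mul_pos (pow_pos hN' 2) (sub_pos.mpr hlt)]

lemma extendedExpectation_renormalizedEnergy
    (h : IsCorrelationFunction P 2 fun x => 1 - T (x 0 - x 1))
    (hT1 : Integrable fun v : ℂ => ‖v‖ * |T v|) {N : ℕ} (hN : 2 ≤ N) :
    (¬ Integrable (fun v : ℂ => Real.log ‖v‖ * T v) →
      extendedExpectation P (renormalizedEnergy N) = ⊤) ∧
    (Integrable (fun v : ℂ => Real.log ‖v‖ * T v) →
      extendedExpectation P (renormalizedEnergy N) =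
        (((∫ v : ℂ, tent (v / N) * (Real.log ‖v‖ * T v)) +
          Real.log (N / etaConst) * (1 - ∫ v : ℂ, tent (v / N) * T v) -
          1 / (2 * Real.pi) * ∫ v : ℂ, tent (v / N) * kroneckerRem (v / N) * T v : ℝ) : EReal)) := by
  have hN0 : 0 < N := by omega
  have hN' : (0 : ℝ) < N := Nat.cast_pos.mpr hN0
  have hTm := h.measurable_of_sub
  have hT := integrable_of_isCorrelationFunction h hT1
  obtain ⟨κ, hκ0, hκ⟩ := exists_neg_le_kroneckerPlane
  set A : ℝ := 1 / (2 * Real.pi * (N : ℝ) ^ 2) with hA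
  have hA0 : 0 < A := by positivity
  set L := Real.log (N / etaConst) with hL
  set φ : ℂ → ℝ := fun v => kroneckerPlane (v / N) + κ with hφ
  have hφm : Measurable φ :=
    (measurable_comp_div_natCast measurable_kroneckerPlane N).add measurable_const
  have hφ0 : ∀ v, 0 ≤ φ v := fun v => by have := hκ (v / N); simp only [hφ]; linarith
  -- The energy is split into a nonnegative part and an integrable part; an infinite expectation can
  -- only come from the former, and the shift κ cancels in the final value.
  have hW : renormalizedEnergy N =ᵐ[P] fun X =>
      A * pairSum N φ X - (A * κ * pairSum N (fun _ => (1 : ℝ)) X - L) := by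
    filter_upwards [ae_pairSum_eisensteinN_eq h hN0] with X hX
    rw [renormalizedEnergy_eq, hX, hφ, pairSum_add_const]
    ring
  have hone := integrable_pairSum_one h hT hN0
  have hrest : Integrable (fun X => A * κ * pairSum N (fun _ => (1 : ℝ)) X - L) P :=
    (hone.const_mul _).sub (integrable_const _)
  have hK := integrable_comp_div_natCast integrable_tent_mul_kroneckerPlane hN0
  have hK0 : ∫ v : ℂ, tent (v / N) * kroneckerPlane (v / N) = 0 := by
    rw [integral_comp_div_natCast fun z => tent z * kroneckerPlane z,
      integral_tent_mul_kroneckerPlane, mul_zero]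
  have htent := integrable_comp_div_natCast integrable_tent hN0
  have htentT := integrable_tent_div_mul hT N
  have hiff : Integrable (pairSum N φ) P ↔ Integrable fun v : ℂ => Real.log ‖v‖ * T v := by
    rw [integrable_pairSum_iff h hN0 hφm hφ0,
      ← integrable_tent_mul_kroneckerPlane_mul_iff hT hTm hT1 hN]
    refine integrable_iff_of_ae_eq_sub_const_mul one_ne_zero
      ((hK.add (htent.const_mul κ)).sub (htentT.const_mul κ)) (Eventually.of_forall fun v => ?_)
    simp only [Pi.add_apply, Pi.sub_apply, hφ]
    ring
  constructor
  · intro hlog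
    rw [extendedExpectation_congr hW]
    refine extendedExpectation_sub_eq_top (fun X => mul_nonneg hA0.le (pairSum_nonneg hφ0 X))
      ((aemeasurable_pairSum_real h hN0 hφm hφ0).const_mul A) ?_ hrest
    rwa [integrable_const_mul_iff (IsUnit.mk0 _ hA0.ne'), hiff]
  · intro hlog
    have hS := hiff.mpr hlog
    have hKT := (integrable_tent_mul_kroneckerPlane_mul_iff hT hTm hT1 hN).mpr hlog
    have hWint : Integrable (fun X => A * pairSum N φ X -
        (A * κ * pairSum N (fun _ => (1 : ℝ)) X - L)) P := (hS.const_mul A).sub hrest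
    rw [extendedExpectation_congr hW, extendedExpectation_of_integrable hWint]
    congr 1
    rw [integral_sub (hS.const_mul A) hrest, integral_sub (hone.const_mul _) (integrable_const _),
      integral_const_mul, integral_const_mul, integral_pairSum h hN0 hφm hφ0,
      integral_pairSum_one h hT hN0, integral_const, probReal_univ, one_smul]
    have e1 : ∫ v : ℂ, φ v * (1 - T v) * tent (v / N) =
        κ * ((N : ℝ) ^ 2 - ∫ v : ℂ, tent (v / N) * T v) -
          ∫ v : ℂ, tent (v / N) * kroneckerPlane (v / N) * T v := by
      have : ∀ v : ℂ, φ v * (1 - T v) * tent (v / N) =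
          (tent (v / N) * kroneckerPlane (v / N) + κ * (tent (v / N) - tent (v / N) * T v)) -
            tent (v / N) * kroneckerPlane (v / N) * T v := fun v => by
        simp only [hφ]; ring
      simp_rw [this]
      have i1 : Integrable fun v : ℂ => κ * (tent (v / N) - tent (v / N) * T v) :=
        (htent.sub htentT).const_mul κ
      have i2 : Integrable fun v : ℂ => tent (v / N) * kroneckerPlane (v / N) +
          κ * (tent (v / N) - tent (v / N) * T v) := hK.add i1
      rw [integral_sub i2 hKT, integral_add hK i1, hK0, integral_const_mul,
        integral_sub htent htentT, integral_comp_div_natCast tent, integral_tent, mul_one, zero_add]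
    have e2 : ∫ v : ℂ, tent (v / N) * kroneckerPlane (v / N) * T v =
        (∫ v : ℂ, tent (v / N) * kroneckerRem (v / N) * T v) +
          2 * Real.pi * L * (∫ v : ℂ, tent (v / N) * T v) -
          2 * Real.pi * ∫ v : ℂ, tent (v / N) * (Real.log ‖v‖ * T v) := by
      have i1 : Integrable fun v : ℂ => tent (v / N) * kroneckerRem (v / N) * T v +
          2 * Real.pi * L * (tent (v / N) * T v) :=
        (integrable_tent_div_mul_kroneckerRem hT N).add (htentT.const_mul _)
      rw [integral_congr_ae (tent_mul_kroneckerPlane_mul_ae_eq hN0 T), integral_sub i1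
        (((integrable_tent_div_mul_log_iff hTm hT1 hN).mpr hlog).const_mul _),
        integral_add (integrable_tent_div_mul_kroneckerRem hT N) (htentT.const_mul _),
        integral_const_mul, integral_const_mul]
    rw [e1, e2, hA]
    have hpi := Real.pi_ne_zero
    field_simp
    ring

end Correlation

/-! ### The limit of large N -/

lemma tendsto_integral_tent_mul {f : ℂ → ℝ} (hf : Integrable f) :
    Tendsto (fun N : ℕ => ∫ v : ℂ, tent (v / N) * f v) atTop (𝓝 (∫ v, f v)) := by
  refine tendsto_integral_of_dominated_convergence (fun v => ‖f v‖)
    (fun N => (integrable_tent_div_mul hf N).aestronglyMeasurable) hf.norm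
    (fun N => Eventually.of_forall fun v => ?_) (Eventually.of_forall fun v => ?_)
  · rw [norm_mul, Real.norm_of_nonneg (tent_nonneg _)]
    exact mul_le_of_le_one_left (norm_nonneg _) (tent_le_one _)
  · simpa using (tendsto_tent_div v).mul_const (f v)

lemma tendsto_integral_tent_mul_kroneckerRem {T : ℂ → ℝ} (hT : Integrable T) :
    Tendsto (fun N : ℕ => ∫ v : ℂ, tent (v / N) * kroneckerRem (v / N) * T v) atTop (𝓝 0) := by
  obtain ⟨C, -, hC⟩ := exists_abs_tent_mul_kroneckerRem_le
  rw [← integral_zero ℂ ℝ (μ := volume)]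
  refine tendsto_integral_of_dominated_convergence (fun v => C * ‖T v‖)
    (fun N => (integrable_tent_div_mul_kroneckerRem hT N).aestronglyMeasurable)
    (hT.norm.const_mul C) (fun N => Eventually.of_forall fun v => ?_) ?_
  · rw [norm_mul]
    exact mul_le_mul_of_nonneg_right (hC _) (norm_nonneg _)
  · filter_upwards [Measure.ae_ne volume (0 : ℂ)] with v hv
    have h1 : Tendsto (fun N : ℕ => v / (N : ℂ)) atTop (𝓝[≠] 0) := by
      refine tendsto_nhdsWithin_iff.mpr ⟨tendsto_div_natCast v, ?_⟩
      filter_upwards [eventually_gt_atTop 0] with N hN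
      exact div_ne_zero hv (Nat.cast_ne_zero.mpr hN.ne')
    simpa using ((tendsto_tent_div v).mul (tendsto_kroneckerRem.comp h1)).mul_const (T v)

lemma tendsto_log_div_etaConst :
    Tendsto (fun N : ℕ => Real.log (N / etaConst)) atTop atTop :=
  Real.tendsto_log_atTop.comp (tendsto_natCast_atTop_atTop.atTop_div_const etaConst_pos)

lemma tendsto_log_div_etaConst_div :
    Tendsto (fun N : ℕ => Real.log (N / etaConst) / N) atTop (𝓝 0) := by
  have h1 : Tendsto (fun x : ℝ => Real.log x / x) atTop (𝓝 0) :=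
    Real.isLittleO_log_id_atTop.tendsto_div_nhds_zero
  have h2 := (h1.comp (tendsto_natCast_atTop_atTop.atTop_div_const etaConst_pos :
    Tendsto (fun N : ℕ => (N : ℝ) / etaConst) atTop atTop)).mul_const etaConst⁻¹
  rw [zero_mul] at h2
  refine h2.congr fun N => ?_
  have := etaConst_pos.ne'
  simp only [Function.comp_apply]
  rcases eq_or_ne (N : ℝ) 0 with h | h
  · simp [h]
  · field_simp

/-- The bound 1 - t(v/N) ≤ 2‖v‖/N and the first moment make the difference O(1/N), while the
prefactor grows only like log N. -/
lemma tendsto_log_mul_integral_sub {T : ℂ → ℝ} (hT : Integrable T)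
    (hT1 : Integrable fun v : ℂ => ‖v‖ * |T v|) :
    Tendsto (fun N : ℕ => Real.log (N / etaConst) *
      ((∫ v, T v) - ∫ v : ℂ, tent (v / N) * T v)) atTop (𝓝 0) := by
  set m := ∫ v : ℂ, ‖v‖ * |T v|
  have h0 : Tendsto (fun N : ℕ => |Real.log (N / etaConst) / N| * (2 * m)) atTop (𝓝 0) := by
    simpa using tendsto_log_div_etaConst_div.abs.mul_const (2 * m)
  refine squeeze_zero_norm (fun N => ?_) h0
  rw [norm_mul, Real.norm_eq_abs, abs_div, div_mul_eq_mul_div, mul_div_assoc]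
  rcases Nat.eq_zero_or_pos N with rfl | hN
  · simp
  have hN' : (0 : ℝ) < N := Nat.cast_pos.mpr hN
  refine mul_le_mul_of_nonneg_left ?_ (abs_nonneg _)
  rw [← integral_sub hT (integrable_tent_div_mul hT N), abs_of_pos hN',
    show 2 * m / (N : ℝ) = ∫ v : ℂ, 2 / (N : ℝ) * (‖v‖ * |T v|) by
      rw [integral_const_mul]; ring]
  refine norm_integral_le_of_norm_le (hT1.const_mul _) (Eventually.of_forall fun v => ?_)
  have h1 := one_sub_tent_le (v / N)
  rw [norm_div, Complex.norm_natCast] at h1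
  rw [show T v - tent (v / N) * T v = (1 - tent (v / N)) * T v by ring, norm_mul,
    Real.norm_of_nonneg (sub_nonneg.mpr (tent_le_one _)), Real.norm_eq_abs]
  calc _ ≤ 2 * (‖v‖ / N) * |T v| := mul_le_mul_of_nonneg_right h1 (abs_nonneg _)
    _ = _ := by ring

theorem theorem2 (P : Measure PointConfiguration) [IsProbabilityMeasure P]
    (ρ₁ : ℂ → ℝ) (ρ₂ : ℂ → ℂ → ℝ) (T₂ : ℂ → ℝ)
    (hcorr₁ : IsCorrelationFunction P 1 (fun x => ρ₁ (x 0)))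
    (hcorr₂ : IsCorrelationFunction P 2 (fun x => ρ₂ (x 0) (x 1)))
    (hρ₁ : ∀ x, ρ₁ x = 1)
    (hρ₂ : ∀ x y, ρ₂ x y = 1 - T₂ (x - y))
    (hmoment : ∀ k ∈ ({1, 2, 3} : Set ℕ), Integrable (fun v : ℂ => ‖v‖ ^ k * |T₂ v|)) :
    ((∫ v, T₂ v) ≠ 1 →
      Tendsto (fun N : ℕ => extendedExpectation P (renormalizedEnergy N)) atTop (𝓝 ⊤)) ∧
    ((∫ v, T₂ v) = 1 →
      (fun N : ℕ => 1 - ∫ v in Set.Icc (-(N : ℝ)) N ×ℂ Set.Icc (-(N : ℝ)) N, T₂ v)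
        =o[atTop] (fun N : ℕ => (Real.log N)⁻¹) →
      ((∃ L : ℝ, Tendsto (fun N : ℕ => extendedExpectation P (renormalizedEnergy N))
          atTop (𝓝 (L : EReal))) ↔
        Integrable (fun v : ℂ => Real.log ‖v‖ * T₂ v)) ∧
      (Integrable (fun v : ℂ => Real.log ‖v‖ * T₂ v) →
        Tendsto (fun N : ℕ => extendedExpectation P (renormalizedEnergy N))
          atTop (𝓝 ((∫ v, Real.log ‖v‖ * T₂ v : ℝ) : EReal)))) := by
  simp_rw [hρ₁] at hcorr₁
  simp_rw [hρ₂] at hcorr₂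
  have hT1 : Integrable fun v : ℂ => ‖v‖ * |T₂ v| := by simpa using hmoment 1 (by simp)
  have hT := integrable_of_isCorrelationFunction hcorr₂ hT1
  have hle : ∫ v, T₂ v ≤ 1 := le_of_tendsto (tendsto_integral_tent_mul hT)
    ((eventually_gt_atTop 0).mono fun N hN => integral_tent_mul_le_one hcorr₁ hcorr₂ hT hN)
  have htop : ¬ Integrable (fun v : ℂ => Real.log ‖v‖ * T₂ v) →
      Tendsto (fun N : ℕ => extendedExpectation P (renormalizedEnergy N)) atTop (𝓝 ⊤) := by
    intro hlog
    refine tendsto_const_nhds.congr' ?_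
    filter_upwards [eventually_ge_atTop 2] with N hN
    exact ((extendedExpectation_renormalizedEnergy hcorr₂ hT1 hN).1 hlog).symm
  set L : ℕ → ℝ := fun N => Real.log (N / etaConst) with hL
  set I : ℝ := ∫ v, T₂ v with hI
  -- This is the convergent part of the expectation; the remaining term (1 - I) L N alone decides
  -- between divergence and convergence.
  set c : ℕ → ℝ := fun N => (∫ v : ℂ, tent (v / N) * (Real.log ‖v‖ * T₂ v)) +
    L N * (I - ∫ v : ℂ, tent (v / N) * T₂ v) -
    1 / (2 * Real.pi) * ∫ v : ℂ, tent (v / N) * kroneckerRem (v / N) * T₂ v with hc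
  have hreal : Integrable (fun v : ℂ => Real.log ‖v‖ * T₂ v) →
      (fun N : ℕ => ((c N + (1 - I) * L N : ℝ) : EReal)) =ᶠ[atTop]
        fun N : ℕ => extendedExpectation P (renormalizedEnergy N) := by
    intro hlog
    filter_upwards [eventually_ge_atTop 2] with N hN
    rw [(extendedExpectation_renormalizedEnergy hcorr₂ hT1 hN).2 hlog]
    congr 1
    simp only [hc, hL]
    ring
  have hclim : Integrable (fun v : ℂ => Real.log ‖v‖ * T₂ v) →
      Tendsto c atTop (𝓝 (∫ v, Real.log ‖v‖ * T₂ v)) := by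
    intro hlog
    have := ((tendsto_integral_tent_mul hlog).add (tendsto_log_mul_integral_sub hT hT1)).sub
      ((tendsto_integral_tent_mul_kroneckerRem hT).const_mul (1 / (2 * Real.pi)))
    rwa [add_zero, mul_zero, sub_zero] at this
  refine ⟨fun hne => ?_, fun hone _ => ?_⟩
  · by_cases hlog : Integrable (fun v : ℂ => Real.log ‖v‖ * T₂ v)
    · refine Tendsto.congr' (hreal hlog) ?_
      rw [EReal.tendsto_coe_nhds_top_iff]
      exact (hclim hlog).add_atTop (tendsto_log_div_etaConst.const_mul_atTop
        (sub_pos.mpr (lt_of_le_of_ne hle hne)))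
    · exact htop hlog
  · have hlim : Integrable (fun v : ℂ => Real.log ‖v‖ * T₂ v) →
        Tendsto (fun N : ℕ => extendedExpectation P (renormalizedEnergy N))
          atTop (𝓝 ((∫ v, Real.log ‖v‖ * T₂ v : ℝ) : EReal)) := by
      intro hlog
      refine Tendsto.congr' (hreal hlog) ?_
      rw [EReal.tendsto_coe, hone]
      simpa using hclim hlog
    refine ⟨⟨fun ⟨l, hl⟩ => ?_, fun hlog => ⟨_, hlim hlog⟩⟩, hlim⟩
    -- If the logarithmic integral diverges, the expectations are eventually +∞, which excludes a
    -- finite limit.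
    by_contra hlog
    exact EReal.coe_ne_top l (tendsto_nhds_unique hl (htop hlog))
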